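/- **Setting.** Let $K$ be a field of characteristic $0$, let $q,t,u\in K^\times$, and fix square roots $q^{1/2},t^{1/2}\in K$, with $(t/q)^{1/2}:=t^{1/2}/q^{1/2}$. Let $\mathcal F=K[p_1,p_2,\dots]\otimes\Lambda[\pi_1,\pi_2,\dots]$ be the space of superpolynomials in commuting variables $p_k$ and anticommuting variables $\pi_k$, with left derivatives $\partial/\partial\pi_k$. Define $c_n[p]$ and $\widetilde c_n[\partial/\partial p]$ by $$\sum_{n\ge0}c_n[p]z^n=\exp\Big(\sum_{r\ge1}\tfrac{1-t^r}{r}p_rz^r\Big),\qquad \sum_{n\ge0}\widetilde c_n[\partial/\partial p]z^{-n}=\exp\Big(\sum_{n\ge1}(q^{-n}-1)\tfrac{\partial}{\partial p_n}z^{-n}\Big),$$ and operators on $\mathcal F$ by $$E_{2,0}=\sum_{k\ge1}c_k[p]\frac{\partial}{\partial\pi_k},\quad F_{1,1}=\frac{\partial}{\partial\pi_1},\quad F_{2,-1}=-\sum_{k\ge1}\pi_k\,\widetilde c_k[\partial/\partial p],\quad F_{1,0}=u^{-1}\sum_{k\ge1}c_{k-1}[p]\frac{\partial}{\partial\pi_k}.$$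 Let $$V_B^{(-)}(w)=\exp\Big(\sum_{k\ge1}\tfrac{1-t^{-k}}{k}p_kw^{2k}\Big),\qquad V_B^{(+)}(w)=\exp\Big(\sum_{k\ge1}(q^k-1)\tfrac{\partial}{\partial p_k}w^{-2k}\Big),$$ $$\widetilde V_F^{(-)}(w)=\exp\Big((1-t^{-1})\sum_{k\ge2}t^{2-k}w^{2k-1}\pi_k\sum_{m=0}^{k-2}t^m\psi_m\Big),$$ $$\widetilde V_F^{(+)}(w)=\exp\Big((q-1)\sum_{k\ge2}q^{k-2}w^{-2k+1}\Big(\sum_{m=0}^{k-2}q^{-m}\psi_m^\dagger\Big)\frac{\partial}{\partial\pi_k}\Big),$$ where $\psi_m,\psi_m^\dagger$ ($m\ge0$) are auxiliary charged fermions that anticommute with all $\pi_k$ and $\partial/\partial\pi_k$, with $\psi_m\psi_n^\dagger+\psi_n^\dagger\psi_m=\delta_{mn}$ (and all other anticommutators among the $\psi_m,\psi_n^\dagger$ zero), $\psi_m|\varnothing\rangle=0$, $\langle\varnothing|\psi_m^\dagger=0$ and $\langle\varnothing|\varnothing\rangle=1$. With $\oint\frac{dw}{w}$ denoting the coefficient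 of $w^0$, put $$X_N=\oint\frac{dw}{w}\,w^{-N}\,V_B^{(-)}(w)V_B^{(+)}(w)\,\langle\varnothing|\widetilde V_F^{(-)}(w)\widetilde V_F^{(+)}(w)|\varnothing\rangle,$$ $$E_{2,1}=-u\,(t/q)^{1/2}\sum_{k\ge1}X_{2k}\,q^k\frac{\partial}{\partial\pi_k},\qquad F_{1,2}=u\sum_{k\ge1}X_{2k-2}\,q^{k-1}\frac{\partial}{\partial\pi_k}.$$ All these sums are finite on each element of $\mathcal F$. Finally let $H_{2,-1}$ be defined by $[E_{2,0},F_{2,-1}]_+=1-(t/q)^{1/2}u\,H_{2,-1}$, where $[A,B]_+=AB+BA$ and $[A,B]=AB-BA$. **Proposition 1.3.** The operator $F_{1,0}$ above satisfies the mode relation $$[H_{2,-1},F_{1,1}]=-(q^{1/2}-q^{-1/2})(t^{1/2}-t^{-1/2})\,F_{1,0}$$ (so it is the operator this relation determines when $q,t\neq1$), and $$[E_{2,1},F_{1,0}]_+=[E_{2,0},F_{1,2}]_+=0 .$$ -/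

import Mathlib

open scoped TensorProduct

namespace SuperMacdonald

noncomputable section

/-! ### Formal series of operators -/

section Formal

variable {K V : Type*} [Field K] [AddCommGroup V] [Module K V]

/-- A family of operators such that only finitely many members act non-trivially on each vector. -/
def LocFin {ι : Type*} (A : ι → Module.End K V) : Prop :=
  ∀ v : V, {i | A i v ≠ 0}.Finite

/-- The sum `∑ i, A i` of a locally finite family of operators. -/
def lfSum {ι : Type*} (A : ι → Module.End K V) (h : LocFin A) : Module.End K V where
  toFun v := ∑ᶠ i, A i v
  map_add' v w := by
    simp only [map_add]
    exact finsum_add_distrib (h v) (h w)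
  map_smul' c v := by
    simp only [map_smul, RingHom.id_apply]
    exact (smul_finsum' c (h v)).symm

theorem LocFin.comp_left {ι : Type*} {B : ι → Module.End K V} (h : LocFin B)
    (A : ι → Module.End K V) : LocFin (fun i => A i * B i) := by
  intro v
  refine (h v).subset fun i hi hB => hi ?_
  simp [Module.End.mul_apply, hB]

theorem LocFin.smul {ι : Type*} {B : ι → Module.End K V} (h : LocFin B)
    (a : ι → K) : LocFin (fun i => a i • B i) := by
  intro v
  refine (h v).subset fun i hi hB => hi ?_
  simp [hB]

variable (K) in
/-- The formal exponential `exp X = ∑ n, X ^ n / n!` of a power series `X` without constant term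
(so that only `n ≤ N` contributes to the coefficient of degree `N`), with coefficients in a
possibly non-commutative algebra. -/
def fexp {A : Type*} [Ring A] [Algebra K A] (X : PowerSeries A) : PowerSeries A :=
  PowerSeries.mk fun N =>
    ∑ n ∈ Finset.range (N + 1), ((n.factorial : K)⁻¹) • PowerSeries.coeff N (X ^ n)

/-- The series `∑ k ≥ 1, a k * z ^ (e k)`, for an exponent function with `k ≤ e k`
(the term with `k = i + 1` contributes to the coefficient of degree `j` only if `i < j`). -/
def gen {A : Type*} [Ring A] (e : ℕ+ → ℕ) (a : ℕ+ → A) : PowerSeries A :=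
  PowerSeries.mk fun j =>
    ∑ i ∈ Finset.range j, if e i.succPNat = j then a i.succPNat else 0

/-- The coefficient of `z ^ n`, `n ∈ ℤ`, of a power series in `z`. -/
def zcoeff {A : Type*} [Ring A] (X : PowerSeries A) (n : ℤ) : A :=
  if 0 ≤ n then PowerSeries.coeff n.toNat X else 0

/-- A filtration by weight: exhaustive, and zero in negative weights. -/
def IsWeight (U : ℤ → Submodule K V) : Prop :=
  (∀ v, ∃ n, v ∈ U n) ∧ ∀ n < 0, U n = ⊥

/-- The `j`-th coefficient lowers the weight by `j`. -/
def Lowers (U : ℤ → Submodule K V) (X : PowerSeries (Module.End K V)) : Prop :=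
  ∀ (j : ℕ) (n : ℤ), ∀ v ∈ U n, PowerSeries.coeff j X v ∈ U (n - j)

theorem Lowers.pow {U : ℤ → Submodule K V} {X : PowerSeries (Module.End K V)}
    (h : Lowers U X) (m : ℕ) : Lowers U (X ^ m) := by
  induction m with
  | zero =>
    intro j n v hv
    rw [pow_zero, PowerSeries.coeff_one]
    split_ifs with hj
    · subst hj; simpa using hv
    · simp
  | succ m ih =>
    intro j n v hv
    rw [pow_succ, PowerSeries.coeff_mul, LinearMap.sum_apply]
    refine Submodule.sum_mem _ fun p hp => ?_
    have hp' : p.1 + p.2 = j := by simpa using hp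
    have := ih p.1 _ _ (h p.2 n v hv)
    rw [Module.End.mul_apply]
    convert this using 2
    rw [← hp']; push_cast; ring

theorem Lowers.fexp {U : ℤ → Submodule K V} {X : PowerSeries (Module.End K V)}
    (h : Lowers U X) : Lowers U (fexp K X) := by
  intro j n v hv
  rw [SuperMacdonald.fexp, PowerSeries.coeff_mk, LinearMap.sum_apply]
  exact Submodule.sum_mem _ fun m _ => Submodule.smul_mem _ _ (h.pow m j n v hv)

theorem Lowers.gen {U : ℤ → Submodule K V} {e : ℕ+ → ℕ} {a : ℕ+ → Module.End K V}
    (h : ∀ (k : ℕ+) (n : ℤ), ∀ v ∈ U n, a k v ∈ U (n - e k)) : Lowers U (gen e a) := by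
  intro j n v hv
  rw [SuperMacdonald.gen, PowerSeries.coeff_mk, LinearMap.sum_apply]
  refine Submodule.sum_mem _ fun i _ => ?_
  split_ifs with hi
  · have := h i.succPNat n v hv
    rwa [hi] at this
  · simp

theorem Lowers.exists_bound {U : ℤ → Submodule K V} (hU : IsWeight U)
    {X : PowerSeries (Module.End K V)} (h : Lowers U X) (v : V) :
    ∃ N : ℕ, ∀ j, N ≤ j → PowerSeries.coeff j X v = 0 := by
  obtain ⟨n, hn⟩ := hU.1 v
  refine ⟨(n + 1).toNat, fun j hj => ?_⟩
  have := h j n v hn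
  rwa [hU.2 _ (by omega), Submodule.mem_bot] at this

theorem Lowers.locFin {U : ℤ → Submodule K V} (hU : IsWeight U)
    {X : PowerSeries (Module.End K V)} (h : Lowers U X) :
    LocFin (fun j => PowerSeries.coeff j X) := by
  intro v
  obtain ⟨N, hN⟩ := h.exists_bound hU v
  refine (Set.finite_lt_nat N).subset fun j hj => ?_
  by_contra hlt
  exact hj (hN j (by simpa using hlt))

theorem zcoeff_neg {A : Type*} [Ring A] (X : PowerSeries A) {n : ℤ} (h : n < 0) :
    zcoeff X n = 0 := by
  simp [zcoeff, h]

end Formal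

/-! ### Bosons: polynomials in the power sums `p_k`, `k ≥ 1` -/

section Bosons

variable (K : Type*) [Field K]

/-- Polynomials in `p_1, p_2, …`. -/
abbrev Bos : Type _ := MvPolynomial ℕ+ K

/-- The derivation `∂/∂p_k`. -/
def dp (k : ℕ+) : Module.End K (Bos K) := (MvPolynomial.pderiv k).toLinearMap

/-- Filtration by the degree with `deg p_k = e k`. -/
def bosU (e : ℕ+ → ℕ) (n : ℤ) : Submodule K (Bos K) :=
  Submodule.span K {x | ∃ s : ℕ+ →₀ ℕ,
    ((Finsupp.weight e s : ℕ) : ℤ) ≤ n ∧ x = MvPolynomial.monomial s 1}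

theorem bosU_isWeight (e : ℕ+ → ℕ) : IsWeight (bosU K e) := by
  constructor
  · intro v
    have mono : ∀ {m n : ℤ}, m ≤ n → bosU K e m ≤ bosU K e n := fun hmn =>
      Submodule.span_mono fun x ⟨s, hs, hx⟩ => ⟨s, hs.trans hmn, hx⟩
    induction v using MvPolynomial.induction_on' with
    | monomial s a =>
      refine ⟨(Finsupp.weight e s : ℕ), ?_⟩
      have : MvPolynomial.monomial s a = a • (MvPolynomial.monomial s (1 : K)) := by
        rw [MvPolynomial.smul_monomial]; simp
      rw [this]
      exact Submodule.smul_mem _ _ (Submodule.subset_span ⟨s, le_rfl, rfl⟩)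
    | add p q hp hq =>
      obtain ⟨n1, h1⟩ := hp
      obtain ⟨n2, h2⟩ := hq
      exact ⟨max n1 n2, Submodule.add_mem _ (mono (le_max_left _ _) h1)
        (mono (le_max_right _ _) h2)⟩
  · intro n hn
    rw [bosU, Submodule.span_eq_bot]
    rintro x ⟨s, hs, -⟩
    omega

theorem dp_mem_bosU (e : ℕ+ → ℕ) (k : ℕ+) (n : ℤ) (v : Bos K) (hv : v ∈ bosU K e n) :
    dp K k v ∈ bosU K e (n - e k) := by
  suffices bosU K e n ≤ (bosU K e (n - e k)).comap (dp K k) from this hv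
  refine Submodule.span_le.2 ?_
  rintro x ⟨s, hs, rfl⟩
  change MvPolynomial.pderiv k (MvPolynomial.monomial s 1) ∈ bosU K e (n - e k)
  rw [MvPolynomial.pderiv_monomial]
  by_cases h0 : s k = 0
  · simp [h0]
  have hsum : s - Finsupp.single k 1 + Finsupp.single k 1 = s := by
    apply tsub_add_cancel_of_le
    simpa [Finsupp.single_le_iff] using Nat.one_le_iff_ne_zero.2 h0
  have hw : Finsupp.weight e (s - Finsupp.single k 1) + e k = Finsupp.weight e s := by
    conv_rhs => rw [← hsum]
    rw [map_add]; simp [Finsupp.weight_apply]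
  have : MvPolynomial.monomial (s - Finsupp.single k 1) (1 * (s k : K))
      = (s k : K) • MvPolynomial.monomial (s - Finsupp.single k 1) (1 : K) := by
    rw [MvPolynomial.smul_monomial]; simp
  rw [this]
  refine Submodule.smul_mem _ _ (Submodule.subset_span ⟨_, ?_, rfl⟩)
  rw [← hw] at hs
  push_cast at hs
  omega

end Bosons

/-! ### Fermions: exterior algebras on a set of anticommuting generators -/

section Fermions

variable (K : Type*) [Field K]

/-- The exterior algebra on generators indexed by `σ`. -/
abbrev Fer (σ : Type*) : Type _ := ExteriorAlgebra K (σ →₀ K)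

variable {σ : Type*}

/-- Left multiplication by the generator `a`. -/
def create (a : σ) : Module.End K (Fer K σ) :=
  LinearMap.mulLeft K (ExteriorAlgebra.ι K (Finsupp.single a 1))

/-- The left derivative (contraction) with respect to the generator `a`. -/
def annih (a : σ) : Module.End K (Fer K σ) :=
  CliffordAlgebra.contractLeft (Q := (0 : QuadraticForm K (σ →₀ K))) (Finsupp.lapply a)

theorem annih_ι_mul (a : σ) (m : σ →₀ K) (x : Fer K σ) :
    annih K a (ExteriorAlgebra.ι K m * x) = m a • x - ExteriorAlgebra.ι K m * annih K a x :=
  CliffordAlgebra.contractLeft_ι_mul _ _ _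

theorem annih_algebraMap (a : σ) (r : K) : annih K a (algebraMap K (Fer K σ) r) = 0 :=
  CliffordAlgebra.contractLeft_algebraMap _ _ _

theorem annih_locFin : LocFin (annih K : σ → Module.End K (Fer K σ)) := by
  intro v
  induction v using CliffordAlgebra.left_induction with
  | algebraMap r =>
    refine Set.finite_empty.subset fun a ha => ha (annih_algebraMap K a r)
  | add x y hx hy =>
    refine (hx.union hy).subset fun a ha => ?_
    by_contra hcon
    simp only [Set.mem_union, Set.mem_ofPred_eq, not_or, not_not] at hcon
    exact ha (by rw [map_add, hcon.1, hcon.2, add_zero])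
  | ι_mul x m hx =>
    refine (m.support.finite_toSet.union hx).subset fun a ha => ?_
    by_contra hcon
    simp only [Set.mem_union, Set.mem_ofPred_eq, not_or, not_not, Finset.mem_coe,
      Finsupp.notMem_support_iff] at hcon
    refine ha ?_
    have := annih_ι_mul K a m x
    rw [hcon.1, hcon.2] at this
    simpa using this

/-- Filtration by the degree in which the generator `a` has degree `wt a`. -/
def ferU (wt : σ → ℕ) (n : ℤ) : Submodule K (Fer K σ) :=
  Submodule.span K {x | ∃ l : List σ, (((l.map wt).sum : ℕ) : ℤ) ≤ n ∧
    x = (l.map fun a => ExteriorAlgebra.ι K (Finsupp.single a (1 : K))).prod}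

theorem ferU_mono (wt : σ → ℕ) {m n : ℤ} (h : m ≤ n) : ferU K wt m ≤ ferU K wt n :=
  Submodule.span_mono fun _ ⟨l, hl, hx⟩ => ⟨l, hl.trans h, hx⟩

theorem create_mem_ferU (wt : σ → ℕ) (a : σ) (n : ℤ) (v : Fer K σ) (hv : v ∈ ferU K wt n) :
    create K a v ∈ ferU K wt (n + wt a) := by
  suffices ferU K wt n ≤ (ferU K wt (n + wt a)).comap (create K a) from this hv
  refine Submodule.span_le.2 ?_
  rintro x ⟨l, hl, rfl⟩
  refine Submodule.subset_span ⟨a :: l, ?_, ?_⟩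
  · simp only [List.map_cons, List.sum_cons]; push_cast at hl ⊢; omega
  · simp [create]

theorem annih_mem_ferU (wt : σ → ℕ) (a : σ) (n : ℤ) (v : Fer K σ) (hv : v ∈ ferU K wt n) :
    annih K a v ∈ ferU K wt (n - wt a) := by
  classical
  suffices ferU K wt n ≤ (ferU K wt (n - wt a)).comap (annih K a) from this hv
  refine Submodule.span_le.2 ?_
  rintro x ⟨l, hl, rfl⟩
  change annih K a _ ∈ ferU K wt (n - wt a)
  clear hv
  induction l generalizing n with
  | nil =>
    have := annih_algebraMap K a (1 : K)
    rw [map_one] at this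
    simp [this]
  | cons b l ih =>
    simp only [List.map_cons, List.sum_cons, List.prod_cons] at hl ⊢
    rw [annih_ι_mul]
    refine Submodule.sub_mem _ ?_ ?_
    · by_cases hab : b = a
      · subst hab
        refine Submodule.smul_mem _ _ (Submodule.subset_span ⟨l, ?_, rfl⟩)
        omega
      · simp [hab]
    · have h1 := ih (n - wt b) (by omega)
      have h2 := create_mem_ferU K wt b _ _ h1
      refine ferU_mono K wt ?_ h2
      omega

theorem ferU_isWeight (wt : σ → ℕ) : IsWeight (ferU K wt) := by
  classical
  constructor
  · intro v
    induction v using CliffordAlgebra.left_induction with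
    | algebraMap r =>
      refine ⟨0, ?_⟩
      rw [Algebra.algebraMap_eq_smul_one]
      exact Submodule.smul_mem _ _ (Submodule.subset_span ⟨[], by simp, by simp⟩)
    | add x y hx hy =>
      obtain ⟨n1, h1⟩ := hx
      obtain ⟨n2, h2⟩ := hy
      exact ⟨max n1 n2, Submodule.add_mem _ (ferU_mono K wt (le_max_left _ _) h1)
        (ferU_mono K wt (le_max_right _ _) h2)⟩
    | ι_mul x m hx =>
      obtain ⟨n, hn⟩ := hx
      change ∃ n, ExteriorAlgebra.ι K m * x ∈ _
      induction m using Finsupp.induction_linear with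
      | zero => exact ⟨0, by simp⟩
      | add f g hf hg =>
        obtain ⟨n1, h1⟩ := hf
        obtain ⟨n2, h2⟩ := hg
        refine ⟨max n1 n2, ?_⟩
        rw [map_add, add_mul]
        exact Submodule.add_mem _ (ferU_mono K wt (le_max_left _ _) h1)
          (ferU_mono K wt (le_max_right _ _) h2)
      | single a c =>
        refine ⟨n + wt a, ?_⟩
        have : Finsupp.single a c = c • Finsupp.single a (1 : K) := by simp
        rw [this, map_smul, smul_mul_assoc]
        exact Submodule.smul_mem _ _ (create_mem_ferU K wt a n x hn)
  · intro n hn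
    rw [ferU, Submodule.span_eq_bot]
    rintro x ⟨s, hs, -⟩
    omega

end Fermions

/-! ### The space of supersymmetric polynomials -/

section Fock

variable (K : Type*) [Field K]

/-- The superalgebra `K[p_1, p_2, …] ⊗ Λ[π_1, π_2, …]`. -/
abbrev Fock : Type _ := Bos K ⊗[K] Fer K ℕ+

/-- The operator `A ⊗ B` on superpolynomials; `A` acts on the `p_k`, `B` on the `π_k`. -/
def tens (A : Module.End K (Bos K)) (B : Module.End K (Fer K ℕ+)) : Module.End K (Fock K) :=
  TensorProduct.map A B

theorem tens_locFin_of {ι : Type*} (A : ι → Module.End K (Bos K))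
    (B : ι → Module.End K (Fer K ℕ+))
    (h : ∀ x y, {i | A i x ≠ 0 ∧ B i y ≠ 0}.Finite) : LocFin (fun i => tens K (A i) (B i)) := by
  intro v
  induction v using TensorProduct.induction_on with
  | zero => simp
  | tmul x y =>
    refine (h x y).subset fun i hi => ⟨fun h0 => hi ?_, fun h0 => hi ?_⟩
    · simp [tens, h0]
    · simp [tens, h0]
  | add x y hx hy =>
    refine (hx.union hy).subset fun a ha => ?_
    by_contra hcon
    simp only [Set.mem_union, Set.mem_ofPred_eq, not_or, not_not] at hcon
    exact ha (by rw [map_add, hcon.1, hcon.2, add_zero])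

/-- Multiplication by `π_k`. -/
def piMul (k : ℕ+) : Module.End K (Fock K) := tens K 1 (create K k)

/-- The left derivative `∂/∂π_k`. -/
def dpi (k : ℕ+) : Module.End K (Fock K) := tens K 1 (annih K k)

theorem dpi_locFin : LocFin (dpi K) :=
  tens_locFin_of K _ _ fun _ y => (annih_locFin K y).subset fun _ hi => hi.2

/-- A polynomial in the `p_k`, acting by multiplication. -/
def polyMul (f : Bos K) : Module.End K (Fock K) := tens K (LinearMap.mulLeft K f) 1

/-- An operator in the `p_k` and `∂/∂p_k`, acting on superpolynomials. -/
def bosOp (A : Module.End K (Bos K)) : Module.End K (Fock K) := tens K A 1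

end Fock

/-! ### The supercharges `E_{2,0}`, `F_{1,1}`, `F_{2,-1}`, `F_{1,0}` -/

section Charges

variable {K : Type*} [Field K]

/-- `c_n[p]`, with `∑ n, c_n[p] z^n = exp (∑ r ≥ 1, (1 - t^r) / r * p_r z^r)`. -/
def cPoly (t : K) (n : ℕ) : Bos K :=
  PowerSeries.coeff n (fexp K (gen (fun r => (r : ℕ))
    fun r => ((1 - t ^ (r : ℕ)) / (r : ℕ)) • (MvPolynomial.X r : Bos K)))

/-- The series `exp (∑ n ≥ 1, (q^{-n} - 1) ∂/∂p_n z^{-n})`, as a power series in `z⁻¹`. -/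
def cTildeSeries (q : K) : PowerSeries (Module.End K (Bos K)) :=
  fexp K (gen (fun n => (n : ℕ)) fun n => (q ^ (-(n : ℤ)) - 1) • dp K n)

/-- `c̃_n[∂/∂p]`. -/
def cTilde (q : K) (n : ℕ) : Module.End K (Bos K) := PowerSeries.coeff n (cTildeSeries q)

theorem lowers_dp (e : ℕ+ → ℕ) (a : ℕ+ → K) :
    Lowers (bosU K e) (fexp K (gen e fun n => a n • dp K n)) :=
  (Lowers.gen fun k n v hv => Submodule.smul_mem _ _ (dp_mem_bosU K e k n v hv)).fexp

theorem cTilde_locFin (q : K) : LocFin (cTilde q) :=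
  (lowers_dp (fun n => (n : ℕ)) fun n => q ^ (-(n : ℤ)) - 1).locFin (bosU_isWeight K _)

/-- `E_{2,0} = ∑ k ≥ 1, c_k[p] ∂/∂π_k`. -/
def E20 (t : K) : Module.End K (Fock K) :=
  lfSum (fun k : ℕ+ => polyMul K (cPoly t k) * dpi K k) ((dpi_locFin K).comp_left _)

/-- `F_{1,1} = ∂/∂π_1`. -/
def F11 : Module.End K (Fock K) := dpi K 1

theorem piMul_cTilde_locFin (q : K) :
    LocFin (fun k : ℕ+ => piMul K k * bosOp K (cTilde q k)) := by
  have h : LocFin (fun k : ℕ+ => bosOp K (cTilde q k)) :=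
    tens_locFin_of K _ _ fun x _ =>
      ((cTilde_locFin q x).preimage PNat.coe_injective.injOn).subset fun _ hi => hi.1
  exact h.comp_left _

/-- `F_{2,-1} = - ∑ k ≥ 1, π_k c̃_k[∂/∂p]`. -/
def F2m1 (q : K) : Module.End K (Fock K) :=
  -lfSum (fun k : ℕ+ => piMul K k * bosOp K (cTilde q k)) (piMul_cTilde_locFin q)

/-- `F_{1,0} = u⁻¹ ∑ k ≥ 1, c_{k-1}[p] ∂/∂π_k`. -/
def F10 (t u : K) : Module.End K (Fock K) :=
  u⁻¹ • lfSum (fun k : ℕ+ => polyMul K (cPoly t ((k : ℕ) - 1)) * dpi K k)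
    ((dpi_locFin K).comp_left _)

/-- `H_{2,-1}`, determined by `[E_{2,0}, F_{2,-1}]_+ = 1 - (t/q)^{1/2} u H_{2,-1}`, where
`s = (t/q)^{1/2}`. -/
def H2m1 (q t u s : K) : Module.End K (Fock K) :=
  (s * u)⁻¹ • (1 - (E20 t * F2m1 q + F2m1 q * E20 t))

end Charges

/-! ### Vertex operators

Here `V^{(-)}(w)` is a power series in `w` and `V^{(+)}(w)` is a power series in `w⁻¹`. -/

section Vertex

variable {K : Type*} [Field K]

/-- `V_B^{(-)}(w) = exp (∑ k ≥ 1, (1 - t^{-k}) / k * p_k w^{2k})`, a series in `w`. -/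
def VBm (t : K) : PowerSeries (Module.End K (Bos K)) :=
  fexp K (gen (fun k => 2 * (k : ℕ)) fun k =>
    ((1 - t ^ (-(k : ℤ))) / (k : ℕ)) • LinearMap.mulLeft K (MvPolynomial.X k : Bos K))

/-- `V_B^{(+)}(w) = exp (∑ k ≥ 1, (q^k - 1) ∂/∂p_k w^{-2k})`, a series in `w⁻¹`. -/
def VBp (q : K) : PowerSeries (Module.End K (Bos K)) :=
  fexp K (gen (fun k => 2 * (k : ℕ)) fun k => (q ^ (k : ℕ) - 1) • dp K k)

theorem VBp_lowers (q : K) : Lowers (bosU K fun k => 2 * (k : ℕ)) (VBp q) :=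
  lowers_dp _ _

theorem vbos_locFin (q t : K) (N : ℤ) :
    LocFin (fun b : ℕ => zcoeff (VBm t) (N + b) * PowerSeries.coeff b (VBp q)) :=
  ((VBp_lowers q).locFin (bosU_isWeight K _)).comp_left _

/-- The coefficient of `w^N` in `V_B^{(-)}(w) V_B^{(+)}(w)`. -/
def vbos (q t : K) (N : ℤ) : Module.End K (Bos K) :=
  lfSum (fun b : ℕ => zcoeff (VBm t) (N + b) * PowerSeries.coeff b (VBp q)) (vbos_locFin q t N)

/-- The generators of the exterior algebra on which the `π_k` (`Sum.inl`) and the auxiliary charged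
fermions (`Sum.inr`) act together, so that the `ψ_m`, `ψ_m†` anticommute with the `π_k` and the
`∂/∂π_k`. -/
abbrev Aux : Type := ℕ+ ⊕ ℕ

variable (K) in
/-- `ψ_m`: it annihilates the vacuum. -/
def psi (m : ℕ) : Module.End K (Fer K Aux) := annih K (Sum.inr m)

variable (K) in
/-- `ψ_m†`, with `ψ_m ψ_n† + ψ_n† ψ_m = δ_{mn}`. -/
def psiDag (m : ℕ) : Module.End K (Fer K Aux) := create K (Sum.inr m)

variable (K) in
/-- `f ↦ f ⊗ |∅⟩`. -/
def ketVac : Fer K ℕ+ →ₗ[K] Fer K Aux :=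
  (ExteriorAlgebra.map (Finsupp.lmapDomain K K (Sum.inl : ℕ+ → Aux))).toLinearMap

variable (K) in
/-- Pairing with `⟨∅|`: the component without auxiliary fermions. -/
def braVac : Fer K Aux →ₗ[K] Fer K ℕ+ :=
  (ExteriorAlgebra.map
    (Finsupp.lcomapDomain (Sum.inl : ℕ+ → Aux) Sum.inl_injective)).toLinearMap

/-- `Ṽ_F^{(-)}(w) = exp ((1 - t⁻¹) ∑ k ≥ 2, t^{2-k} w^{2k-1} π_k ∑ m = 0..k-2, t^m ψ_m)`,
a series in `w`. The sum over `m` is empty for `k = 1`. -/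
def VFm (t : K) : PowerSeries (Module.End K (Fer K Aux)) :=
  fexp K (gen (fun k => 2 * (k : ℕ) - 1) fun k =>
    ((1 - t⁻¹) * t ^ (2 - (k : ℤ))) •
      (create K (Sum.inl k) * ∑ m ∈ Finset.range ((k : ℕ) - 1), t ^ m • psi K m))

/-- `Ṽ_F^{(+)}(w) = exp ((q - 1) ∑ k ≥ 2, q^{k-2} w^{-2k+1} (∑ m = 0..k-2, q^{-m} ψ_m†) ∂/∂π_k)`,
a series in `w⁻¹`. The sum over `m` is empty for `k = 1`. -/
def VFp (q : K) : PowerSeries (Module.End K (Fer K Aux)) :=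
  fexp K (gen (fun k => 2 * (k : ℕ) - 1) fun k =>
    ((q - 1) * q ^ ((k : ℤ) - 2)) •
      ((∑ m ∈ Finset.range ((k : ℕ) - 1), q ^ (-(m : ℤ)) • psiDag K m) * annih K (Sum.inl k)))

/-- The degrees used for local finiteness: `π_k` has degree `2k - 1`, `ψ†` has degree `0`. -/
def auxWt : Aux → ℕ := Sum.elim (fun k => 2 * (k : ℕ) - 1) fun _ => 0

theorem VFp_lowers (q : K) : Lowers (ferU K auxWt) (VFp q) := by
  refine (Lowers.gen fun k n v hv => ?_).fexp
  have h := annih_mem_ferU K auxWt (Sum.inl k) n v hv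
  rw [LinearMap.smul_apply, Module.End.mul_apply, LinearMap.sum_apply]
  refine Submodule.smul_mem _ _ (Submodule.sum_mem _ fun m _ => Submodule.smul_mem _ _ ?_)
  have h2 := create_mem_ferU K auxWt (Sum.inr m) _ _ h
  simpa [auxWt, psiDag] using h2

/-- The contribution of the `w^c` term of `Ṽ_F^{(-)}` and of the `w^{-d}` term of `Ṽ_F^{(+)}` to
the vacuum expectation value `⟨∅| Ṽ_F^{(-)}(w) Ṽ_F^{(+)}(w) |∅⟩`, an operator in the `π_k` and
`∂/∂π_k`. -/
def vevTerm (q t : K) (c : ℤ) (d : ℕ) : Module.End K (Fer K ℕ+) :=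
  braVac K ∘ₗ (zcoeff (VFm t) c * PowerSeries.coeff d (VFp q)) ∘ₗ ketVac K

theorem vferm_bound (q : K) (y : Fer K ℕ+) :
    ∃ D : ℕ, ∀ d, D ≤ d → PowerSeries.coeff d (VFp q) (ketVac K y) = 0 :=
  (VFp_lowers q).exists_bound (ferU_isWeight K _) _

theorem vferm_locFin (q t : K) (N : ℤ) : LocFin (fun d : ℕ => vevTerm q t (N + d) d) := by
  intro y
  obtain ⟨D, hD⟩ := vferm_bound q y
  refine (Set.finite_lt_nat D).subset fun d hd => ?_
  by_contra hlt
  refine hd ?_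
  simp [vevTerm, hD d (by simpa using hlt)]

/-- The coefficient of `w^N` in `⟨∅| Ṽ_F^{(-)}(w) Ṽ_F^{(+)}(w) |∅⟩`. -/
def vferm (q t : K) (N : ℤ) : Module.End K (Fer K ℕ+) :=
  lfSum (fun d : ℕ => vevTerm q t (N + d) d) (vferm_locFin q t N)

theorem vertex_locFin (q t : K) (N : ℤ) :
    LocFin (fun i : ℤ => tens K (vbos q t i) (vferm q t (N - i))) := by
  refine tens_locFin_of K _ _ fun x y => ?_
  obtain ⟨B, hB⟩ := (VBp_lowers q).exists_bound (bosU_isWeight K _) x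
  obtain ⟨D, hD⟩ := vferm_bound q y
  refine (Set.finite_Icc (-(B : ℤ)) (N + D)).subset fun i hi => ?_
  by_contra hcon
  rw [Set.mem_Icc, not_and_or, not_le, not_le] at hcon
  rcases hcon with h | h
  · refine hi.1 ?_
    change ∑ᶠ b : ℕ, _ = _
    refine finsum_eq_zero_of_forall_eq_zero fun b => ?_
    beta_reduce
    by_cases hb : B ≤ b
    · rw [Module.End.mul_apply, hB b hb, map_zero]
    · rw [zcoeff_neg _ (by omega), zero_mul, LinearMap.zero_apply]
  · refine hi.2 ?_
    change ∑ᶠ d : ℕ, _ = _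
    refine finsum_eq_zero_of_forall_eq_zero fun d => ?_
    beta_reduce
    by_cases hd : D ≤ d
    · simp [vevTerm, hD d hd]
    · rw [vevTerm, zcoeff_neg _ (by omega), zero_mul]
      simp

/-- `∮ dw/w w^{-N} V_B^{(-)}(w) V_B^{(+)}(w) ⟨∅| Ṽ_F^{(-)}(w) Ṽ_F^{(+)}(w) |∅⟩`, that is the
coefficient of `w^N` of the product. -/
def vertex (q t : K) (N : ℤ) : Module.End K (Fock K) :=
  lfSum (fun i : ℤ => tens K (vbos q t i) (vferm q t (N - i))) (vertex_locFin q t N)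

/-- `E_{2,1}`, determined by
`u⁻¹ (q/t)^{1/2} E_{2,1} = - ∑ k ≥ 1, ∮ dw/w w^{-2k} V_B^{(-)} V_B^{(+)} ⟨Ṽ_F^{(-)} Ṽ_F^{(+)}⟩ q^k ∂/∂π_k`,
where `s = (t/q)^{1/2}`. -/
def E21 (q t u s : K) : Module.End K (Fock K) :=
  -((u * s) • lfSum
    (fun k : ℕ+ => q ^ (k : ℕ) • (vertex q t (2 * (k : ℤ)) * dpi K k))
    (((dpi_locFin K).comp_left _).smul _))

/-- `F_{1,2}`, determined by
`u⁻¹ F_{1,2} = ∑ k ≥ 1, ∮ dw/w w^{-2k+2} V_B^{(-)} V_B^{(+)} ⟨Ṽ_F^{(-)} Ṽ_F^{(+)}⟩ q^{k-1} ∂/∂π_k`. -/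
def F12 (q t u : K) : Module.End K (Fock K) :=
  u • lfSum
    (fun k : ℕ+ => q ^ ((k : ℕ) - 1) • (vertex q t (2 * (k : ℤ) - 2) * dpi K k))
    (((dpi_locFin K).comp_left _).smul _)

end Vertex

end

end SuperMacdonald

/-! Write ∂_k for ∂/∂π_k. Up to nonzero scalars both anticommutators are cases of one statement,
`cCharge_vCharge_anticomm`: for r = 0, 1 the operators ∑ c_{k-r} ∂_k and ∑ q^k X_{2k+2r-2} ∂_k
anticommute. The case r = 1 concerns F_{1,0} and E_{2,1}, the case r = 0 concerns E_{2,0} and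
F_{1,2}.

Two exchange relations bring every term to the form c_a X_M ∂_j ∂_k. Contracting the auxiliary
fermions gives ∂_l X_N = ∑_j `fermMat` l j · X_{N-2l+2j} ∂_j (`dpi_vertex`). Since V_B^{(+)} shifts
p_r by (q^r - 1) w^{-2r}, one has X_N c_n = ∑_i e_i c_{n-i} X_{N+2i}, where ∑ e_i x^i =
(1-x)(1-qtx)/((1-qx)(1-tx)) (`vertex_polyMul_cPoly`). As ∂_k ∂_j = -∂_j ∂_k, the coefficient in the
anticommutator is q^k (`fermMat` l j - e_{j-l}) with l = a + r. By `fermMat_sub_exchange` the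
bracket is a rank one matrix, proportional to t^{-l} h_j with h_j = ∑_{m ≤ j-2} t^m q^{j-2-m}, plus
a multiple of q^{j-1} present only for l = 0. The latter yields q^{j+k}, symmetric in j and k, and
cancels against ∂_j ∂_k.

In the rank one term the sum over a can be done: ∑ c_a t^{-a} w^{2a} is the inverse of V_B^{(-)}(w),
so only V_B^{(+)} remains, with nonpositive powers of w. What must vanish is then ∑_{j,k} h_j q^k
Y_{2(j+k)+N} ∂_j ∂_k for N ≥ -2, where Y_M is the fermionic coefficient `vferm`
(`sum_vferm_annih_annih`). An element of the exterior algebra with zero constant term that is killed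
by every ∂_l is zero, which permits an induction on fermionic degree. Moving ∂_l through Y produces
`fermMat` l i, which is a rank one matrix in h_i plus a remainder supported on i ≥ l. The rank one
part has the symmetric factor h_i h_j and cancels; the remainder is the same expression for ∂_i y
with N raised by 2(i-l) ≥ 0.

The mode relation is a super Jacobi computation: ∂_1 anticommutes with E_{2,0}, its anticommutator
with F_{2,-1} is a multiple of ∂/∂p_1, and ∂c_n/∂p_1 = (1-t) c_{n-1}. -/

namespace SuperMacdonald

/-! ### Formal exponentials with noncommuting coefficients -/

section Generic

theorem lfSum_apply {K V : Type*} [Field K] [AddCommGroup V] [Module K V] {ι : Type*}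
    (A : ι → Module.End K V) (h : LocFin A) (v : V) : lfSum A h v = ∑ᶠ i, A i v := rfl

theorem coeff_pow_eq_zero {A : Type*} [Ring A] {X : PowerSeries A} (h0 : PowerSeries.coeff 0 X = 0)
    {n N : ℕ} (h : N < n) : PowerSeries.coeff N (X ^ n) = 0 := by
  induction n generalizing N with
  | zero => omega
  | succ n ih =>
    rw [pow_succ, PowerSeries.coeff_mul]
    refine Finset.sum_eq_zero fun p hp => ?_
    have hp' : p.1 + p.2 = N := by simpa using hp
    rcases Nat.eq_zero_or_pos p.2 with h2 | h2
    · rw [h2, h0, mul_zero]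
    · rw [ih (by omega), zero_mul]

variable (K : Type*) [Field K]

/-- The exponential truncated after `m` terms. -/
noncomputable def truncExp {A : Type*} [Ring A] [Algebra K A] (m : ℕ) (X : A) : A :=
  ∑ n ∈ Finset.range m, ((n.factorial : K)⁻¹) • X ^ n

/-- Without constant term, X^n starts in degree n, so the terms beyond N do not reach the
coefficient of degree N. Identities for `fexp` thereby reduce to finite algebraic ones. -/
theorem coeff_fexp_eq_truncExp {A : Type*} [Ring A] [Algebra K A] {X : PowerSeries A}
    (h0 : PowerSeries.coeff 0 X = 0) {m N : ℕ} (h : N < m) :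
    PowerSeries.coeff N (fexp K X) = PowerSeries.coeff N (truncExp K m X) := by
  rw [fexp, PowerSeries.coeff_mk, truncExp, map_sum]
  have : Finset.range (N + 1) ⊆ Finset.range m := by
    intro x; simp; omega
  rw [← Finset.sum_subset this]
  · refine Finset.sum_congr rfl fun n _ => ?_
    rw [PowerSeries.coeff_smul]
  · intro n _ hn
    rw [PowerSeries.coeff_smul, coeff_pow_eq_zero h0 (by simpa using hn), smul_zero]

/-- As Y commutes with X, commuting D past X^(n+1) gives (n+1) X^n Y, and the factor n+1 cancels
against the factorial. One power of X is lost, hence the shorter truncation in the last term. -/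
theorem mul_truncExp [CharZero K] {A : Type*} [Ring A] [Algebra K A] {D X Y : A}
    (hD : D * X = X * D + Y) (hXY : Commute X Y) (m : ℕ) :
    D * truncExp K (m + 1) X = truncExp K (m + 1) X * D + truncExp K m X * Y := by
  have hpow : ∀ n : ℕ, D * X ^ (n + 1) = X ^ (n + 1) * D + ((n + 1 : ℕ) : K) • (X ^ n * Y) := by
    intro n
    induction n with
    | zero => simpa using hD
    | succ n ih =>
      have hc : X ^ n * Y * X = X ^ (n + 1) * Y := by
        rw [mul_assoc, ← hXY.eq, ← mul_assoc, pow_succ]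
      rw [pow_succ, ← mul_assoc, ih, add_mul, mul_assoc, hD, mul_add, ← mul_assoc, ← pow_succ,
        smul_mul_assoc, hc, add_assoc]
      congr 1
      push_cast
      module
  rw [truncExp, Finset.sum_range_succ', truncExp, mul_add, add_mul, Finset.mul_sum, Finset.sum_mul,
    Finset.sum_mul]
  have : ∀ n ∈ Finset.range m, D * (((n + 1).factorial : K)⁻¹ • X ^ (n + 1))
      = ((n + 1).factorial : K)⁻¹ • X ^ (n + 1) * D + (n.factorial : K)⁻¹ • X ^ n * Y := by
    intro n _
    rw [mul_smul_comm, hpow, smul_add, smul_mul_assoc, smul_mul_assoc, smul_smul]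
    congr 2
    rw [Nat.factorial_succ]
    push_cast
    have h1 : ((n : K) + 1) ≠ 0 := by exact_mod_cast Nat.succ_ne_zero n
    have h2 : (n.factorial : K) ≠ 0 := by exact_mod_cast n.factorial_ne_zero
    field_simp
  rw [Finset.sum_congr rfl this, Finset.sum_add_distrib]
  simp
  abel

theorem C_mul_fexp [CharZero K] {A : Type*} [Ring A] [Algebra K A] {D : A} {X Y : PowerSeries A}
    (h0 : PowerSeries.coeff 0 X = 0)
    (hD : PowerSeries.C D * X = X * PowerSeries.C D + Y) (hXY : Commute X Y) :
    PowerSeries.C D * fexp K X = fexp K X * PowerSeries.C D + fexp K X * Y := by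
  ext N
  have key := congrArg (PowerSeries.coeff N) (mul_truncExp K hD hXY (N + 1))
  rw [map_add, PowerSeries.coeff_C_mul, PowerSeries.coeff_mul_C] at key ⊢
  rw [coeff_fexp_eq_truncExp K h0 (show N < N + 1 + 1 by omega), key]
  congr 1
  rw [PowerSeries.coeff_mul, PowerSeries.coeff_mul]
  refine Finset.sum_congr rfl fun p hp => ?_
  have hp' : p.1 + p.2 = N := by simpa using hp
  rw [coeff_fexp_eq_truncExp K h0 (show p.1 < N + 1 by omega)]

variable {K}
theorem zcoeff_natCast {A : Type*} [Ring A] (X : PowerSeries A) (n : ℕ) :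
    zcoeff X (n : ℤ) = PowerSeries.coeff n X := by
  simp [zcoeff]

/-- The index set is left free, so that coefficients of several degrees can be written over one
common finite set. -/
theorem coeff_gen {A : Type*} [Ring A] {e : ℕ+ → ℕ} (he : ∀ k : ℕ+, (k : ℕ) ≤ e k) (a : ℕ+ → A) {j : ℕ}
    {S : Finset ℕ+} (hS : ∀ k, e k ≤ j → k ∈ S) :
    PowerSeries.coeff j (gen e a) = ∑ k ∈ S, if e k = j then a k else 0 := by
  classical
  rw [gen, PowerSeries.coeff_mk]
  have : ∀ i ∈ Finset.range j, (if e i.succPNat = j then a i.succPNat else 0)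
    = (fun k : ℕ+ => if e k = j then a k else 0) (Nat.succPNat i) := fun _ _ => rfl
  rw [Finset.sum_congr rfl this, ← Finset.sum_image (s := Finset.range j) (g := Nat.succPNat)
    (f := fun k : ℕ+ => if e k = j then a k else 0) (Nat.succPNat_injective.injOn)]
  have hl : ∀ T : Finset ℕ+, (∀ k, e k = j → k ∈ T) →
      ∑ k ∈ T, (if e k = j then a k else 0)
        = ∑ k ∈ S.filter (fun k => e k = j), a k := by
    intro T hT
    rw [← Finset.sum_filter]
    congr 1
    ext k
    simp only [Finset.mem_filter]
    exact ⟨fun h => ⟨hS k h.2.le, h.2⟩, fun h => ⟨hT k h.2, h.2⟩⟩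
  rw [hl _ fun k hk => ?_, hl S fun k hk => hS k hk.le]
  have h1 := he k
  have h2 := k.pos
  refine Finset.mem_image.2 ⟨k.natPred, ?_, PNat.succPNat_natPred k⟩
  rw [Finset.mem_range]
  have := PNat.natPred_add_one k
  omega

theorem coeff_zero_gen {A : Type*} [Ring A] {e : ℕ+ → ℕ} (a : ℕ+ → A) :
    PowerSeries.coeff 0 (gen e a) = 0 := by
  simp [gen]

theorem zcoeff_mul_gen {A : Type*} [Ring A] {e : ℕ+ → ℕ} (he : ∀ k : ℕ+, (k : ℕ) ≤ e k) (F : PowerSeries A)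
    (a : ℕ+ → A) {n : ℤ} {S : Finset ℕ+} (hS : ∀ k, (e k : ℤ) ≤ n → k ∈ S) :
    zcoeff (F * gen e a) n = ∑ k ∈ S, zcoeff F (n - e k) * a k := by
  rcases lt_or_ge n 0 with hn | hn
  · rw [zcoeff_neg _ hn]
    symm
    refine Finset.sum_eq_zero fun k _ => ?_
    rw [zcoeff_neg _ (by omega), zero_mul]
  · lift n to ℕ using hn
    rw [zcoeff_natCast, PowerSeries.coeff_mul]
    have : ∀ p ∈ Finset.HasAntidiagonal.antidiagonal n, PowerSeries.coeff p.1 F * PowerSeries.coeff p.2 (gen e a)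
        = ∑ k ∈ S, if e k = p.2 then PowerSeries.coeff p.1 F * a k else 0 := by
      intro p hp
      have hp' : p.1 + p.2 = n := by simpa using hp
      rw [coeff_gen he a (S := S) fun k hk => hS k (by omega), Finset.mul_sum]
      simp
    rw [Finset.sum_congr rfl this, Finset.sum_comm]
    refine Finset.sum_congr rfl fun k _ => ?_
    by_cases hk : e k ≤ n
    · rw [Finset.sum_eq_single (n - e k, e k)]
      · rw [if_pos rfl]
        congr 1
        rw [← zcoeff_natCast]
        congr 1
        dsimp only
        omega
      · rintro ⟨a, b⟩ hp hne
        rw [if_neg]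
        rintro rfl
        have hp' : a + e k = n := by simpa using hp
        apply hne
        ext <;> simp
        omega
      · intro h
        exfalso
        apply h
        simp
        omega
    · rw [zcoeff_neg _ (by omega), zero_mul]
      refine Finset.sum_eq_zero fun p hp => ?_
      have hp' : p.1 + p.2 = n := by simpa using hp
      rw [if_neg (by omega)]

theorem C_mul_gen {A : Type*} [Ring A] {e : ℕ+ → ℕ} {D : A}
    {a b : ℕ+ → A} (h : ∀ k, D * a k = a k * D + b k) :
    PowerSeries.C D * gen e a = gen e a * PowerSeries.C D + gen e b := by
  ext N
  rw [map_add, PowerSeries.coeff_C_mul, PowerSeries.coeff_mul_C, gen, gen, PowerSeries.coeff_mk,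
    PowerSeries.coeff_mk, Finset.mul_sum, Finset.sum_mul, ← Finset.sum_add_distrib]
  refine Finset.sum_congr rfl fun i _ => ?_
  split_ifs
  · exact h _
  · simp

theorem commute_gen {A : Type*} [Ring A] {e : ℕ+ → ℕ} {a b : ℕ+ → A}
    (h : ∀ k l, Commute (a k) (b l)) : Commute (gen e a) (gen e b) := by
  change _ = _
  have hc : ∀ i j, PowerSeries.coeff i (gen e a) * PowerSeries.coeff j (gen e b)
      = PowerSeries.coeff j (gen e b) * PowerSeries.coeff i (gen e a) := by
    intro i j
    rw [gen, gen, PowerSeries.coeff_mk, PowerSeries.coeff_mk]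
    refine (Commute.sum_left _ _ _ fun k _ => Commute.sum_right _ _ _ fun l _ => ?_).eq
    split_ifs
    · exact h _ _
    all_goals simp
  ext N
  rw [PowerSeries.coeff_mul, PowerSeries.coeff_mul, ← Finset.Nat.sum_antidiagonal_swap]
  exact Finset.sum_congr rfl fun p _ => hc _ _

/-- If `[D, X] = Y` commutes with `X` then `D exp X = exp X (D + Y)`. -/
theorem mul_zcoeff_fexp_gen [CharZero K] {A : Type*} [Ring A] [Algebra K A] {e : ℕ+ → ℕ}
    (he : ∀ k : ℕ+, (k : ℕ) ≤ e k) {D : A} {a b : ℕ+ → A} (h : ∀ k, D * a k = a k * D + b k)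
    (hc : ∀ k l, Commute (a k) (b l)) {n : ℤ} {S : Finset ℕ+} (hS : ∀ k, (e k : ℤ) ≤ n → k ∈ S) :
    D * zcoeff (fexp K (gen e a)) n = zcoeff (fexp K (gen e a)) n * D
      + ∑ k ∈ S, zcoeff (fexp K (gen e a)) (n - e k) * b k := by
  rw [← zcoeff_mul_gen he _ _ hS]
  have key := C_mul_fexp K (coeff_zero_gen a) (C_mul_gen (e := e) h) (commute_gen hc)
  rcases lt_or_ge n 0 with hn | hn
  · simp [zcoeff_neg _ hn]
  · lift n to ℕ using hn
    simp only [zcoeff_natCast]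
    have := congrArg (PowerSeries.coeff n) key
    rwa [map_add, PowerSeries.coeff_C_mul, PowerSeries.coeff_mul_C] at this

theorem commute_zcoeff_fexp_gen [CharZero K] {A : Type*} [Ring A] [Algebra K A] {e : ℕ+ → ℕ}
    (he : ∀ k : ℕ+, (k : ℕ) ≤ e k) {D : A} {a : ℕ+ → A} (h : ∀ k, D * a k = a k * D) (n : ℤ) :
    D * zcoeff (fexp K (gen e a)) n = zcoeff (fexp K (gen e a)) n * D := by
  have hf : {k : ℕ+ | (e k : ℤ) ≤ n}.Finite := by
    refine Set.Finite.subset (((Set.finite_Iic n.toNat).preimage PNat.coe_injective.injOn)) ?_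
    intro k hk
    have := he k
    simp only [Set.mem_preimage, Set.mem_Iic, Set.mem_ofPred_eq] at hk ⊢
    omega
  have := mul_zcoeff_fexp_gen (K := K) he (D := D) (a := a) (b := 0) (by simpa using h)
    (fun _ _ => Commute.zero_right _) (n := n) (S := hf.toFinset) (by simp)
  simpa using this

/-- A linear map that kills the range of every coefficient of the exponent. -/
theorem map_zcoeff_fexp_gen {V W : Type*} [AddCommGroup V] [Module K V] [AddCommGroup W] [Module K W]
    {e : ℕ+ → ℕ} (L : V →ₗ[K] W) {a : ℕ+ → Module.End K V}
    (h : ∀ k v, L (a k v) = 0) (n : ℤ) (v : V) :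
    L (zcoeff (fexp K (gen e a)) n v) = if n = 0 then L v else 0 := by
  rcases lt_or_ge n 0 with hn | hn
  · rw [zcoeff_neg _ hn, if_neg (by omega)]; simp
  · lift n to ℕ using hn
    have hX : ∀ j v, L (PowerSeries.coeff j (gen e a) v) = 0 := by
      intro j v
      rw [gen, PowerSeries.coeff_mk, LinearMap.sum_apply, map_sum]
      refine Finset.sum_eq_zero fun i _ => ?_
      split_ifs
      · exact h _ _
      · simp
    have hp : ∀ m j v, L ((PowerSeries.coeff j (gen e a ^ (m + 1)) : Module.End K V) v) = 0 := by
      intro m j v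
      rw [pow_succ', PowerSeries.coeff_mul, LinearMap.sum_apply, map_sum]
      exact Finset.sum_eq_zero fun p _ => hX _ _
    rw [zcoeff_natCast, fexp, PowerSeries.coeff_mk, LinearMap.sum_apply, map_sum,
      Finset.sum_range_succ', Finset.sum_eq_zero]
    · simp only [pow_zero, PowerSeries.coeff_one]
      rcases Nat.eq_zero_or_pos n with rfl | h
      · simp
      · rw [if_neg (by omega), if_neg (by omega)]; simp
    · intro m _
      rw [LinearMap.smul_apply, map_smul, hp, smul_zero]

end Generic

/-! ### Formal exponentials over commutative algebras -/

section Commutative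

variable {K : Type*} [Field K] [CharZero K] {A : Type*} [CommRing A] [Algebra K A]

theorem derivative_fexp {X : PowerSeries A} (h0 : PowerSeries.coeff 0 X = 0) :
    PowerSeries.derivative A (fexp K X) = PowerSeries.derivative A X * fexp K X := by
  have hd : ∀ m, PowerSeries.derivative A (truncExp K (m + 1) X)
      = PowerSeries.derivative A X * truncExp K m X := by
    intro m
    rw [truncExp, map_sum, Finset.sum_range_succ', truncExp, Finset.mul_sum]
    have hsm : ∀ (c : K) (Y : PowerSeries A), PowerSeries.derivative A (c • Y)
        = c • PowerSeries.derivative A Y := by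
      intro c Y
      rw [← algebraMap_smul A c Y, Derivation.map_smul, algebraMap_smul]
    simp only [hsm, pow_zero, PowerSeries.derivative_one, smul_zero, add_zero]
    refine Finset.sum_congr rfl fun n _ => ?_
    rw [PowerSeries.derivative_pow, Nat.factorial_succ]
    have h1 : ((n : K) + 1) ≠ 0 := by exact_mod_cast Nat.succ_ne_zero n
    have h2 : (n.factorial : K) ≠ 0 := by exact_mod_cast n.factorial_ne_zero
    have h3 : ((n + 1 : ℕ) : PowerSeries A) = algebraMap K _ ((n : K) + 1) := by simp
    rw [Nat.add_sub_cancel, h3, mul_assoc, ← Algebra.smul_def, smul_smul, mul_smul_comm, mul_comm (X ^ n)]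
    congr 1
    push_cast
    field_simp
  ext N
  have key := congrArg (PowerSeries.coeff N) (hd (N + 1))
  rw [PowerSeries.coeff_derivative] at key ⊢
  rw [coeff_fexp_eq_truncExp K h0 (show N + 1 < N + 1 + 1 by omega), key, PowerSeries.coeff_mul,
    PowerSeries.coeff_mul]
  refine Finset.sum_congr rfl fun p hp => ?_
  have hp' : p.1 + p.2 = N := by simpa using hp
  rw [coeff_fexp_eq_truncExp K h0 (show p.2 < N + 1 by omega)]

omit [CharZero K] in
theorem coeff_zero_fexp (X : PowerSeries A) : PowerSeries.coeff 0 (fexp K X) = 1 := by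
  simp [fexp]

/-- The product has derivative zero and constant term 1, and without additive torsion these two data
determine a power series. -/
theorem fexp_neg_mul_fexp {X : PowerSeries A} (h0 : PowerSeries.coeff 0 X = 0) :
    fexp K (-X) * fexp K X = 1 := by
  -- Torsion-freeness of `A` comes from the copy of ℚ inside `K`.
  let _ : Module ℚ A := Module.compHom A (algebraMap ℚ K)
  have : IsAddTorsionFree A := IsAddTorsionFree.of_module_rat A
  apply PowerSeries.derivative.ext
  · rw [Derivation.leibniz, derivative_fexp h0, derivative_fexp (by simpa using h0)]
    simp only [smul_eq_mul, map_neg, PowerSeries.derivative_one]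
    ring
  · rw [map_mul, ← PowerSeries.coeff_zero_eq_constantCoeff_apply,
      ← PowerSeries.coeff_zero_eq_constantCoeff_apply, coeff_zero_fexp, coeff_zero_fexp]
    simp

end Commutative

/-! ### Anticommutation relations, and the vacuum maps -/

section Clifford

variable (K : Type*) [Field K] {σ : Type*}

theorem annih_mul_create [DecidableEq σ] (a b : σ) :
    annih K a * create K b = (if a = b then 1 else 0) - create K b * annih K a := by
  apply LinearMap.ext
  intro x
  have := annih_ι_mul K a (Finsupp.single b 1) x
  refine this.trans ?_
  congr 1
  rw [Finsupp.single_apply]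
  by_cases h : a = b
  · rw [if_pos h, if_pos h.symm]; simp
  · rw [if_neg h, if_neg (Ne.symm h)]; simp

theorem annih_mul_create_of_ne {a b : σ} (h : a ≠ b) :
    annih K a * create K b = -(create K b * annih K a) := by
  classical
  rw [annih_mul_create, if_neg h, zero_sub]

theorem annih_mul_annih (a b : σ) : annih K a * annih K b = -(annih K b * annih K a) := by
  apply LinearMap.ext
  intro x
  exact CliffordAlgebra.contractLeft_comm (Q := (0 : QuadraticForm K (σ →₀ K))) _ _ x

theorem annih_annih (a b : σ) (x : Fer K σ) : annih K a (annih K b x) = -annih K b (annih K a x) :=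
  CliffordAlgebra.contractLeft_comm (Q := (0 : QuadraticForm K (σ →₀ K))) _ _ x

theorem braVac_algebraMap (r : K) :
    braVac K (algebraMap K (Fer K Aux) r) = algebraMap K (Fer K ℕ+) r :=
  AlgHom.commutes _ _

theorem ketVac_algebraMap (r : K) :
    ketVac K (algebraMap K (Fer K ℕ+) r) = algebraMap K (Fer K Aux) r :=
  AlgHom.commutes _ _

/-- The vacuum maps are algebra homomorphisms induced by linear maps of the generators, so
compatibility with contraction is checked one generator at a time. -/
theorem annih_braVac (l : ℕ+) (z : Fer K Aux) :
    annih K l (braVac K z) = braVac K (annih K (Sum.inl l) z) := by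
  induction z using CliffordAlgebra.left_induction with
  | algebraMap r =>
    change annih K l (braVac K (algebraMap K (Fer K Aux) r))
      = braVac K (annih K _ (algebraMap K (Fer K Aux) r))
    rw [annih_algebraMap, braVac_algebraMap, annih_algebraMap, map_zero]
  | add x y hx hy => simp only [map_add, hx, hy]
  | ι_mul x m hx =>
    change annih K l (braVac K (ExteriorAlgebra.ι K m * x))
      = braVac K (annih K _ (ExteriorAlgebra.ι K m * x))
    rw [annih_ι_mul, map_sub, map_smul]
    simp only [braVac, AlgHom.toLinearMap_apply, map_mul, ExteriorAlgebra.map_apply_ι] at hx ⊢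
    rw [annih_ι_mul, hx]
    simp

theorem annih_inl_ketVac (l : ℕ+) (z : Fer K ℕ+) :
    annih K (Sum.inl l) (ketVac K z) = ketVac K (annih K l z) := by
  induction z using CliffordAlgebra.left_induction with
  | algebraMap r =>
    change annih K _ (ketVac K (algebraMap K (Fer K ℕ+) r))
      = ketVac K (annih K _ (algebraMap K (Fer K ℕ+) r))
    rw [annih_algebraMap, ketVac_algebraMap, annih_algebraMap, map_zero]
  | add x y hx hy => simp only [map_add, hx, hy]
  | ι_mul x m hx =>
    change annih K _ (ketVac K (ExteriorAlgebra.ι K m * x))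
      = ketVac K (annih K _ (ExteriorAlgebra.ι K m * x))
    rw [annih_ι_mul, map_sub, map_smul]
    simp only [ketVac, AlgHom.toLinearMap_apply, map_mul, ExteriorAlgebra.map_apply_ι] at hx ⊢
    rw [annih_ι_mul, hx]
    simp [Finsupp.mapDomain_apply Sum.inl_injective]

theorem annih_inr_ketVac (m : ℕ) (z : Fer K ℕ+) :
    annih K (Sum.inr m) (ketVac K z) = 0 := by
  induction z using CliffordAlgebra.left_induction with
  | algebraMap r =>
    change annih K _ (ketVac K (algebraMap K (Fer K ℕ+) r)) = 0
    rw [ketVac_algebraMap, annih_algebraMap]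
  | add x y hx hy => simp only [map_add, hx, hy, add_zero]
  | ι_mul x n hx =>
    change annih K _ (ketVac K (ExteriorAlgebra.ι K n * x)) = 0
    simp only [ketVac, AlgHom.toLinearMap_apply, map_mul, ExteriorAlgebra.map_apply_ι] at hx ⊢
    rw [annih_ι_mul, hx]
    simp [Finsupp.mapDomain_of_notMem_range]

theorem braVac_psiDag (m : ℕ) (z : Fer K Aux) : braVac K (psiDag K m z) = 0 := by
  simp only [psiDag, create, braVac, AlgHom.toLinearMap_apply, LinearMap.mulLeft_apply, map_mul,
    ExteriorAlgebra.map_apply_ι]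
  have : (Finsupp.lcomapDomain (R := K) (M := K) (Sum.inl : ℕ+ → Aux) Sum.inl_injective)
      (Finsupp.single (Sum.inr m) (1 : K)) = 0 := by
    ext k; simp
  rw [this, map_zero, zero_mul]

theorem braVac_create_inl (k : ℕ+) (z : Fer K Aux) :
    braVac K (create K (Sum.inl k) z) = create K k (braVac K z) := by
  simp only [create, braVac, AlgHom.toLinearMap_apply, LinearMap.mulLeft_apply, map_mul,
    ExteriorAlgebra.map_apply_ι]
  congr 2
  ext j
  simp [Finsupp.single_apply]

theorem braVac_ketVac (z : Fer K ℕ+) : braVac K (ketVac K z) = z := by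
  induction z using CliffordAlgebra.left_induction with
  | algebraMap r =>
    change braVac K (ketVac K (algebraMap K (Fer K ℕ+) r)) = algebraMap K (Fer K ℕ+) r
    rw [ketVac_algebraMap, braVac_algebraMap]
  | add x y hx hy => simp only [map_add, hx, hy]
  | ι_mul x n hx =>
    change braVac K (ketVac K (ExteriorAlgebra.ι K n * x)) = ExteriorAlgebra.ι K n * x
    simp only [ketVac, braVac, AlgHom.toLinearMap_apply, map_mul, ExteriorAlgebra.map_apply_ι]
      at hx ⊢
    rw [hx]
    congr 2
    ext j
    simp [Finsupp.mapDomain_apply Sum.inl_injective]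

end Clifford

/-! ### Moving ∂/∂π and ψ through the fermionic vertex operators -/

section Pairing

variable {K V : Type*} [Field K] [AddCommGroup V] [Module K V]

theorem commute_mul_of_anticommute {x y z : Module.End K V} (hx : x * z = -(z * x))
    (hy : y * z = -(z * y)) : Commute (x * y) z := by
  change x * y * z = z * (x * y)
  rw [mul_assoc, hy, mul_neg, ← mul_assoc, hx, neg_mul, neg_neg, mul_assoc]

theorem End.mul_zcoeff_fexp_gen [CharZero K] {e : ℕ+ → ℕ}
    (he : ∀ k : ℕ+, (k : ℕ) ≤ e k) {D : Module.End K V} {a b : ℕ+ → Module.End K V}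
    (h : ∀ k, D * a k = a k * D + b k)
    (hc : ∀ k l, Commute (a k) (b l)) {n : ℤ} {S : Finset ℕ+} (hS : ∀ k, (e k : ℤ) ≤ n → k ∈ S) :
    D * zcoeff (fexp K (gen e a)) n = zcoeff (fexp K (gen e a)) n * D
      + ∑ k ∈ S, zcoeff (fexp K (gen e a)) (n - e k) * b k :=
  SuperMacdonald.mul_zcoeff_fexp_gen he h hc hS

theorem mul_smul_mul_eq_add {x y p d : Module.End K V} (c : K)
    (h1 : x * y = d - y * x) (h2 : x * p = -(p * x)) :
    x * (c • (y * p)) = (c • (y * p)) * x + c • (d * p) := by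
  rw [mul_smul_comm, ← mul_assoc, h1, sub_mul, mul_assoc, h2, mul_neg, sub_neg_eq_add, smul_add,
    smul_mul_assoc, mul_assoc, add_comm]

theorem mul_smul_mul_eq_add_smul {x p d : Module.End K V} (c g : K)
    (h1 : p * d = g • 1 - d * p) (h2 : x * p = -(p * x)) :
    p * (c • (d * x)) = (c • (d * x)) * p + (c * g) • x := by
  have h3 : p * x = -(x * p) := by rw [h2, neg_neg]
  rw [mul_smul_comm, ← mul_assoc, h1, sub_mul, mul_assoc, h3, mul_neg, sub_neg_eq_add, smul_add,
    smul_mul_assoc, smul_mul_assoc, mul_assoc, add_comm, one_mul, smul_smul]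

/-- `∑ m = 0..k-2, t^m ψ_m`. -/
noncomputable def psiSum (t : K) (k : ℕ) : Module.End K (Fer K Aux) :=
  ∑ m ∈ Finset.range (k - 1), t ^ m • psi K m

/-- `∑ m = 0..k-2, q^{-m} ψ_m†`. -/
noncomputable def psiDagSum (q : K) (k : ℕ) : Module.End K (Fer K Aux) :=
  ∑ m ∈ Finset.range (k - 1), q ^ (-(m : ℤ)) • psiDag K m

/-- The anticommutator of `psiSum t l` and `psiDagSum q k`. -/
noncomputable def pairSum (q t : K) (l k : ℕ) : K :=
  ∑ m ∈ Finset.range (min l k - 1), t ^ m * q ^ (-(m : ℤ))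

theorem annih_inl_mul_psiSum (l : ℕ+) (t : K) (k : ℕ) :
    annih K (Sum.inl l) * psiSum t k = -(psiSum t k * annih K (Sum.inl l)) := by
  rw [psiSum, Finset.mul_sum, Finset.sum_mul, ← Finset.sum_neg_distrib]
  refine Finset.sum_congr rfl fun m _ => ?_
  rw [mul_smul_comm, smul_mul_assoc, psi, annih_mul_annih, smul_neg]

theorem annih_inl_mul_psiDagSum (l : ℕ+) (q : K) (k : ℕ) :
    annih K (Sum.inl l) * psiDagSum q k = -(psiDagSum q k * annih K (Sum.inl l)) := by
  rw [psiDagSum, Finset.mul_sum, Finset.sum_mul, ← Finset.sum_neg_distrib]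
  refine Finset.sum_congr rfl fun m _ => ?_
  rw [mul_smul_comm, smul_mul_assoc, psiDag, annih_mul_create_of_ne K (by simp), smul_neg]

theorem create_inl_mul_psiSum (l : ℕ+) (t : K) (k : ℕ) :
    create K (Sum.inl l) * psiSum t k = -(psiSum t k * create K (Sum.inl l)) := by
  rw [psiSum, Finset.mul_sum, Finset.sum_mul, ← Finset.sum_neg_distrib]
  refine Finset.sum_congr rfl fun m _ => ?_
  rw [mul_smul_comm, smul_mul_assoc, psi, annih_mul_create_of_ne K (by simp), smul_neg, neg_neg]

theorem psiSum_mul_psiSum (t : K) (k l : ℕ) :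
    psiSum t k * psiSum t l = -(psiSum t l * psiSum t k) := by
  rw [psiSum, psiSum, Finset.sum_mul_sum, Finset.sum_mul_sum, Finset.sum_comm,
    ← Finset.sum_neg_distrib]
  refine Finset.sum_congr rfl fun m _ => ?_
  rw [← Finset.sum_neg_distrib]
  refine Finset.sum_congr rfl fun n _ => ?_
  rw [smul_mul_smul_comm, smul_mul_smul_comm, psi, psi, annih_mul_annih, smul_neg, mul_comm (t ^ m)]

theorem psiSum_mul_psiDagSum (q t : K) (l k : ℕ) :
    psiSum t l * psiDagSum q k = pairSum q t l k • 1 - psiDagSum q k * psiSum t l := by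
  rw [psiSum, psiDagSum, Finset.sum_mul_sum, Finset.sum_mul_sum,
    Finset.sum_comm (s := Finset.range (k - 1)), eq_sub_iff_add_eq, ← Finset.sum_add_distrib]
  have h : ∀ m n : ℕ, (t ^ m • psi K m) * (q ^ (-(n : ℤ)) • psiDag K n)
      + (q ^ (-(n : ℤ)) • psiDag K n) * (t ^ m • psi K m)
      = if m = n then (t ^ m * q ^ (-(m : ℤ))) • (1 : Module.End K (Fer K Aux)) else 0 := by
    intro m n
    rw [smul_mul_smul_comm, smul_mul_smul_comm, psi, psiDag, annih_mul_create,
      mul_comm (q ^ (-(n : ℤ))), ← smul_add, sub_add_cancel]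
    by_cases hmn : m = n
    · subst hmn; simp
    · rw [if_neg (by simpa using hmn), if_neg hmn, smul_zero]
  simp_rw [← Finset.sum_add_distrib, h]
  simp only [Finset.sum_ite_eq]
  rw [← Finset.sum_filter, pairSum, Finset.sum_smul]
  refine Finset.sum_congr ?_ fun _ _ => rfl
  ext m
  simp
  omega

variable [CharZero K]

theorem le_two_mul_sub_one (k : ℕ+) : (k : ℕ) ≤ 2 * (k : ℕ) - 1 := by
  have := k.pos
  omega

/-- In the exponent ∂/∂π_l meets only π_l and leaves the ψ-sum attached to it. That ψ-sum commutes
with the exponent, so it appears exactly once. -/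
theorem annih_mul_zcoeff_VFm (t : K) (l : ℕ+) (n : ℤ) :
    annih K (Sum.inl l) * zcoeff (VFm t) n = zcoeff (VFm t) n * annih K (Sum.inl l)
      + ((1 - t⁻¹) * t ^ (2 - (l : ℤ))) • (zcoeff (VFm t) (n - (2 * l - 1)) * psiSum t l) := by
  classical
  have hf : {k : ℕ+ | ((2 * (k : ℕ) - 1 : ℕ) : ℤ) ≤ n}.Finite := by
    refine Set.Finite.subset (((Set.finite_Iic n.toNat).preimage PNat.coe_injective.injOn)) ?_
    intro k hk
    have := le_two_mul_sub_one k
    simp only [Set.mem_preimage, Set.mem_Iic, Set.mem_ofPred_eq] at hk ⊢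
    omega
  have key := End.mul_zcoeff_fexp_gen (K := K) (e := fun k => 2 * (k : ℕ) - 1) le_two_mul_sub_one
    (D := annih K (Sum.inl l)) (a := fun k => ((1 - t⁻¹) * t ^ (2 - (k : ℤ))) •
      (create K (Sum.inl k) * psiSum t k))
    (b := fun k => if k = l then ((1 - t⁻¹) * t ^ (2 - (k : ℤ))) • psiSum t k else 0)
    -- The index l is inserted because its term is kept even when 2l - 1 > n, where its coefficient
    -- vanishes.
    (S := insert l hf.toFinset) (n := n) ?_ ?_ (by intro k hk; simpa using Or.inr hk)
  · refine key.trans ?_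
    congr 1
    simp only [mul_ite, mul_zero]
    rw [Finset.sum_ite_eq' , if_pos (by simp), mul_smul_comm]
    have : ((2 * (l : ℕ) - 1 : ℕ) : ℤ) = 2 * l - 1 := by have := l.pos; omega
    rw [this]
    rfl
  · intro k
    refine (mul_smul_mul_eq_add _ (annih_mul_create K _ _) (annih_inl_mul_psiSum _ _ _)).trans ?_
    congr 1
    by_cases h : k = l
    · subst h; simp
    · rw [if_neg h, if_neg (by simpa using Ne.symm h)]; simp
  · intro k m
    split_ifs
    · exact ((commute_mul_of_anticommute (create_inl_mul_psiSum _ _ _)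
        (psiSum_mul_psiSum _ _ _)).smul_left _).smul_right _
    · exact Commute.zero_right _

theorem annih_mul_zcoeff_VFp (q : K) (l : ℕ+) (n : ℤ) :
    annih K (Sum.inl l) * zcoeff (VFp q) n = zcoeff (VFp q) n * annih K (Sum.inl l) := by
  refine commute_zcoeff_fexp_gen le_two_mul_sub_one (fun k => ?_) n
  change _ * (_ • (psiDagSum q k * _)) = (_ • (psiDagSum q k * _)) * _
  rw [mul_smul_comm, smul_mul_assoc, commute_mul_of_anticommute
    (by rw [annih_inl_mul_psiDagSum, neg_neg]) (annih_mul_annih K _ _)]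

/-- Contracting ψ with the ψ† of the k-th term leaves ∂/∂π_k with weight `pairSum`; since ∂/∂π_k
commutes with the exponent there is a single contraction. -/
theorem psiSum_mul_zcoeff_VFp (q t : K) (l : ℕ) (n : ℤ) {S : Finset ℕ+}
    (hS : ∀ k : ℕ+, 2 * (k : ℤ) - 1 ≤ n → k ∈ S) :
    psiSum t l * zcoeff (VFp q) n = zcoeff (VFp q) n * psiSum t l
      + ∑ k ∈ S, ((q - 1) * q ^ ((k : ℤ) - 2) * pairSum q t l k) •
        (zcoeff (VFp q) (n - (2 * k - 1)) * annih K (Sum.inl k)) := by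
  have hcast : ∀ k : ℕ+, ((2 * (k : ℕ) - 1 : ℕ) : ℤ) = 2 * k - 1 := by
    intro k; have := k.pos; omega
  refine (End.mul_zcoeff_fexp_gen (K := K) (e := fun k => 2 * (k : ℕ) - 1) le_two_mul_sub_one
    (D := psiSum t l) (a := fun k => ((q - 1) * q ^ ((k : ℤ) - 2)) •
      (psiDagSum q k * annih K (Sum.inl k)))
    (b := fun k => ((q - 1) * q ^ ((k : ℤ) - 2) * pairSum q t l k) • annih K (Sum.inl k))
    (S := S) (n := n) ?_ ?_ (fun k hk => hS k (by rwa [hcast] at hk))).trans ?_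
  · intro k
    exact mul_smul_mul_eq_add_smul _ _ (psiSum_mul_psiDagSum _ _ _ _) (annih_inl_mul_psiSum _ _ _)
  · intro k m
    exact ((commute_mul_of_anticommute (by rw [annih_inl_mul_psiDagSum, neg_neg])
      (annih_mul_annih K _ _)).smul_left _).smul_right _
  · congr 1
    refine Finset.sum_congr rfl fun k _ => ?_
    rw [hcast, mul_smul_comm]
    rfl

end Pairing

/-! ### Antisymmetric sums and sums over the integers -/

section Sums

theorem sum_sum_eq_zero_of_antisymm {K V ι : Type*} [Field K] [CharZero K] [AddCommGroup V]
    [Module K V] (S : Finset ι) (f : ι → ι → V) (h : ∀ i ∈ S, ∀ j ∈ S, f i j = -f j i) :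
    ∑ i ∈ S, ∑ j ∈ S, f i j = 0 := by
  have h1 : ∑ i ∈ S, ∑ j ∈ S, f i j = -∑ i ∈ S, ∑ j ∈ S, f i j := by
    conv_lhs => rw [Finset.sum_comm]
    rw [← Finset.sum_neg_distrib]
    refine Finset.sum_congr rfl fun i hi => ?_
    rw [← Finset.sum_neg_distrib]
    exact Finset.sum_congr rfl fun j hj => h j hj i hi
  have h2 : (2 : K) • ∑ i ∈ S, ∑ j ∈ S, f i j = 0 := by
    rw [two_smul]
    nth_rw 1 [h1]
    exact neg_add_cancel _
  exact (smul_eq_zero.1 h2).resolve_left two_ne_zero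

/-- Sums over ℤ can be shifted freely, which is how the mode index is translated below. -/
theorem finsum_natCast {V : Type*} [AddCommMonoid V] (f : ℤ → V) (h : ∀ n < 0, f n = 0) :
    ∑ᶠ n : ℕ, f n = ∑ᶠ n : ℤ, f n := by
  rw [← finsum_mem_range Nat.cast_injective, ← finsum_mem_univ (f := f)]
  refine finsum_mem_inter_support_eq _ _ _ ?_
  ext n
  simp only [Set.mem_inter_iff, Set.mem_range, Function.mem_support, Set.mem_univ, true_and,
    and_iff_right_iff_imp]
  intro hn
  rcases lt_or_ge n 0 with h0 | h0
  · exact absurd (h n h0) hn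
  · exact ⟨n.toNat, by simpa using h0⟩

theorem finsum_sub_right {V : Type*} [AddCommMonoid V] (f : ℤ → V) (c : ℤ) :
    ∑ᶠ n : ℤ, f (n - c) = ∑ᶠ n : ℤ, f n :=
  finsum_comp_equiv (Equiv.subRight c)

end Sums

/-! ### Moving ∂/∂π through the vacuum expectation value -/

section Vev

variable {K : Type*} [Field K]

/-- `vevTerm` with an integral exponent of `w⁻¹`. -/
noncomputable def vevZ (q t : K) (c d : ℤ) : Module.End K (Fer K ℕ+) :=
  braVac K ∘ₗ (zcoeff (VFm t) c * zcoeff (VFp q) d) ∘ₗ ketVac K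

theorem vevZ_apply (q t : K) (c d : ℤ) (y : Fer K ℕ+) :
    vevZ q t c d y = braVac K (zcoeff (VFm t) c (zcoeff (VFp q) d (ketVac K y))) := rfl

theorem vferm_apply (q t : K) (N : ℤ) (y : Fer K ℕ+) :
    vferm q t N y = ∑ᶠ d : ℤ, vevZ q t (N + d) d y := by
  rw [← finsum_natCast]
  · change ∑ᶠ d : ℕ, _ = _
    refine finsum_congr fun d => ?_
    rw [vevZ, zcoeff_natCast]
    rfl
  · intro n hn
    rw [vevZ_apply, zcoeff_neg _ hn]
    simp

theorem exists_vevZ_bound (q : K) (y : Fer K ℕ+) :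
    ∃ D : ℤ, ∀ (t : K) (c d : ℤ), D ≤ d → vevZ q t c d y = 0 := by
  obtain ⟨D, hD⟩ := vferm_bound q y
  refine ⟨D, fun t c d hd => ?_⟩
  lift d to ℕ using by omega
  rw [vevZ_apply, zcoeff_natCast, hD d (by omega)]
  simp

theorem vevZ_finite (q t : K) (y : Fer K ℕ+) (c : ℤ → ℤ) (e : ℤ) :
    (Function.support fun d : ℤ => vevZ q t (c d) (d - e) y).Finite := by
  obtain ⟨D, hD⟩ := exists_vevZ_bound q y
  refine (Set.finite_Ico e (D + e)).subset fun d hd => ?_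
  rw [Set.mem_Ico]
  by_contra hcon
  refine hd ?_
  beta_reduce
  by_cases h : d < e
  · rw [vevZ_apply, zcoeff_neg (VFp q) (by omega)]
    simp
  · exact hD _ _ _ (by omega)

theorem exists_vferm_bound (q t : K) (y : Fer K ℕ+) :
    ∃ D : ℤ, ∀ N : ℤ, N < D → vferm q t N y = 0 := by
  obtain ⟨D, hD⟩ := exists_vevZ_bound q y
  refine ⟨-D, fun N hN => ?_⟩
  rw [vferm_apply]
  refine finsum_eq_zero_of_forall_eq_zero fun d => ?_
  by_cases h : D ≤ d
  · exact hD _ _ _ h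
  · rw [vevZ_apply, zcoeff_neg (VFm t) (by omega)]
    simp

/-- The matrix by which `∂/∂π_l` is transformed when it is moved through the fermionic vertex
operator. -/
noncomputable def fermMat (q t : K) (l j : ℕ) : K :=
  (if l = j then 1 else 0) + (1 - t⁻¹) * t ^ (2 - (l : ℤ)) *
    ((q - 1) * q ^ ((j : ℤ) - 2) * pairSum q t l j)

variable [CharZero K]

/-- A Wick contraction: ∂/∂π_l either passes through, or becomes a ψ-sum at V^{(-)} that turns into
∂/∂π_j at V^{(+)}. An uncontracted ψ reaches the vacuum and dies. -/
theorem annih_vevZ (q t : K) (l : ℕ+) (c d : ℤ) {S : Finset ℕ+} {y : Fer K ℕ+}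
    (hS : ∀ j ∉ S, annih K j y = 0) :
    annih K l (vevZ q t c d y) = vevZ q t c d (annih K l y)
      + ∑ j ∈ S, ((1 - t⁻¹) * t ^ (2 - (l : ℤ)) * ((q - 1) * q ^ ((j : ℤ) - 2) * pairSum q t l j)) •
          vevZ q t (c - (2 * l - 1)) (d - (2 * j - 1)) (annih K j y) := by
  have hf : {k : ℕ+ | 2 * (k : ℤ) - 1 ≤ d}.Finite := by
    refine Set.Finite.subset (((Set.finite_Iic d.toNat).preimage PNat.coe_injective.injOn)) ?_
    intro k hk
    have := k.pos
    simp only [Set.mem_preimage, Set.mem_Iic, Set.mem_ofPred_eq] at hk ⊢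
    omega
  have h1 := fun v => LinearMap.congr_fun (annih_mul_zcoeff_VFm t l c) v
  have h2 := LinearMap.congr_fun (annih_mul_zcoeff_VFp q l d) (ketVac K y)
  -- The larger index set is needed for the commutation formula; the indices outside `S` contribute
  -- nothing because ∂/∂π_j y = 0 there.
  have h3 := LinearMap.congr_fun (psiSum_mul_zcoeff_VFp q t l d (S := hf.toFinset ∪ S)
    (fun k hk => Finset.mem_union_left _ (by simpa using hk))) (ketVac K y)
  have h4 : psiSum t l (ketVac K y) = 0 := by
    rw [psiSum, LinearMap.sum_apply]
    refine Finset.sum_eq_zero fun m _ => ?_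
    rw [LinearMap.smul_apply, psi, annih_inr_ketVac, smul_zero]
  simp only [Module.End.mul_apply, LinearMap.add_apply, LinearMap.smul_apply, LinearMap.sum_apply,
    annih_inl_ketVac, h4, map_zero, zero_add] at h1 h2 h3
  rw [vevZ_apply, annih_braVac, h1, h2, h3, map_add, ← vevZ_apply, map_smul, map_sum, map_sum,
    Finset.smul_sum]
  congr 1
  symm
  refine (Finset.sum_subset Finset.subset_union_right fun j _ hj => ?_).trans
    (Finset.sum_congr rfl fun j _ => ?_)
  · rw [hS j hj, map_zero, smul_zero]
  · rw [map_smul, map_smul, smul_smul, ← vevZ_apply]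

/-- A contraction uses up w^{2l-1} from V^{(-)} and w^{-(2j-1)} from V^{(+)}, so the mode N becomes
N - 2l + 2j. For the uncontracted term j = l this shift is zero, and both kinds of term merge into
`fermMat`. -/
theorem annih_vferm (q t : K) (l : ℕ+) (N : ℤ) {S : Finset ℕ+} {y : Fer K ℕ+}
    (hS : ∀ j ∉ S, annih K j y = 0) :
    annih K l (vferm q t N y)
      = ∑ j ∈ S, fermMat q t l j • vferm q t (N - 2 * l + 2 * j) (annih K j y) := by
  have h0 : ∀ c : ℤ → ℤ, ∀ z, (Function.support fun d : ℤ => vevZ q t (c d) d z).Finite := by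
    intro c z
    simpa using vevZ_finite q t z c 0
  rw [vferm_apply, map_finsum _ (h0 _ _)]
  simp_rw [annih_vevZ q t l _ _ hS]
  rw [finsum_add_distrib (h0 _ _), finsum_sum_comm, ← vferm_apply]
  · have h1 : vferm q t N (annih K l y) = ∑ j ∈ S, (if (l : ℕ) = j then (1 : K) else 0) •
        vferm q t (N - 2 * l + 2 * j) (annih K j y) := by
      by_cases hl : l ∈ S
      · rw [Finset.sum_eq_single l]
        · simp
        · intro b _ hb
          rw [if_neg (by simpa using Ne.symm hb), zero_smul]
        · exact fun h => absurd hl h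
      · rw [hS l hl, map_zero]
        symm
        refine Finset.sum_eq_zero fun j hj => ?_
        rw [if_neg, zero_smul]
        intro h
        exact hl (PNat.coe_injective h ▸ hj)
    rw [h1, ← Finset.sum_add_distrib]
    refine Finset.sum_congr rfl fun j _ => ?_
    have h2 : ∑ᶠ d : ℤ, vevZ q t (N + d - (2 * l - 1)) (d - (2 * j - 1)) (annih K j y)
        = vferm q t (N - 2 * l + 2 * j) (annih K j y) := by
      rw [vferm_apply, ← finsum_sub_right
        (fun d => vevZ q t (N - 2 * l + 2 * j + d) d (annih K j y)) (2 * j - 1)]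
      refine finsum_congr fun d => ?_
      have e : N + d - (2 * l - 1) = N - 2 * l + 2 * j + (d - (2 * j - 1)) := by ring
      rw [e]
    rw [← smul_finsum' _ (vevZ_finite q t _ _ _), h2, fermMat, add_smul]
  · intro j _
    refine (vevZ_finite q t (annih K j y) (fun d => N + d - (2 * l - 1)) (2 * j - 1)).subset ?_
    intro d hd h
    exact hd (by beta_reduce at h ⊢; rw [h, smul_zero])
  · refine (S.finite_toSet.biUnion fun j _ =>
      vevZ_finite q t (annih K j y) (fun d => N + d - (2 * l - 1)) (2 * j - 1)).subset ?_
    intro d hd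
    by_contra hcon
    refine hd (Finset.sum_eq_zero fun j hj => ?_)
    simp only [Set.mem_iUnion, not_exists, Function.mem_support, not_not] at hcon
    rw [hcon j hj, smul_zero]

end Vev

/-! ### The number operator and detection of zero by derivatives -/

section Detect

variable (K : Type*) [Field K] {σ : Type*}

/-- Multiplication by the degree, as the sum of all `π_k ∂/∂π_k`. -/
noncomputable def numberOp : Module.End K (Fer K σ) :=
  lfSum (fun a => create K a * annih K a) ((annih_locFin K).comp_left _)

theorem numberOp_prod (l : List σ) :
    numberOp K (l.map fun a => ExteriorAlgebra.ι K (Finsupp.single a (1 : K))).prod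
      = (l.length : K) • (l.map fun a => ExteriorAlgebra.ι K (Finsupp.single a (1 : K))).prod := by
  classical
  have hfin : ∀ x : Fer K σ, (Function.support fun a => annih K a x).Finite := annih_locFin K
  induction l with
  | nil =>
    have := fun a : σ => annih_algebraMap K a (1 : K)
    simp only [map_one] at this
    simp [numberOp, lfSum_apply, this]
  | cons b l ih =>
    simp only [List.map_cons, List.prod_cons, List.length_cons]
    set x := (l.map fun a => ExteriorAlgebra.ι K (Finsupp.single a (1 : K))).prod with hx
    have key : ∀ a, (create K a * annih K a) (ExteriorAlgebra.ι K (Finsupp.single b (1 : K)) * x)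
        = (if a = b then create K b x else 0)
          + ExteriorAlgebra.ι K (Finsupp.single b (1 : K)) * (create K a * annih K a) x := by
      intro a
      rw [Module.End.mul_apply, annih_ι_mul, map_sub, map_smul, sub_eq_add_neg]
      congr 1
      · by_cases h : a = b
        · subst h; simp
        · rw [if_neg h, Finsupp.single_apply, if_neg (Ne.symm h), zero_smul]
      · simp only [create, LinearMap.mulLeft_apply, Module.End.mul_apply]
        rw [← mul_assoc, ← mul_assoc, ← neg_mul]
        congr 1
        rw [neg_eq_iff_add_eq_zero]
        exact ExteriorAlgebra.ι_add_mul_swap _ _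
    rw [numberOp, lfSum_apply, finsum_congr key, finsum_add_distrib]
    · rw [finsum_eq_single _ b (fun a h => if_neg h), if_pos rfl]
      have h2 : ∑ᶠ a, ExteriorAlgebra.ι K (Finsupp.single b (1 : K)) * (create K a * annih K a) x
          = ExteriorAlgebra.ι K (Finsupp.single b (1 : K)) * numberOp K x := by
        rw [numberOp, lfSum_apply]
        exact ((LinearMap.mulLeft K
          (ExteriorAlgebra.ι K (Finsupp.single b (1 : K)))).toAddMonoidHom.map_finsum
          ((annih_locFin K).comp_left (create K) x)).symm
      rw [h2, ih, mul_smul_comm]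
      simp only [create, LinearMap.mulLeft_apply]
      push_cast
      rw [add_smul, one_smul, add_comm]
    · refine (Set.finite_singleton b).subset fun a ha => ?_
      by_contra h
      exact ha (if_neg h)
    · refine (hfin x).subset fun a ha h => ha ?_
      beta_reduce at h ⊢
      rw [Module.End.mul_apply, h, map_zero, mul_zero]

/-- Products of n + 1 generators are eigenvectors with eigenvalue n + 1, so the difference loses its
top degree part. -/
theorem numberOp_sub_mem (n : ℕ) {y : Fer K σ} (hy : y ∈ ferU K (fun _ => 1) (n + 1)) :
    numberOp K y - ((n + 1 : ℕ) : K) • y ∈ ferU K (fun _ => 1) n := by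
  suffices ferU K (fun _ : σ => 1) (n + 1)
      ≤ (ferU K (fun _ => 1) n).comap (numberOp K - ((n + 1 : ℕ) : K) • LinearMap.id) from this hy
  refine Submodule.span_le.2 ?_
  rintro x ⟨l, hl, rfl⟩
  change numberOp K _ - ((n + 1 : ℕ) : K) • _ ∈ ferU K (fun _ => 1) n
  rw [numberOp_prod, LinearMap.id_apply, ← sub_smul]
  simp only [List.map_const', List.sum_replicate, smul_eq_mul, mul_one] at hl
  rcases eq_or_ne l.length (n + 1) with h | h
  · rw [h, sub_self, zero_smul]
    exact Submodule.zero_mem _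
  · refine Submodule.smul_mem _ _ (Submodule.subset_span ⟨l, ?_, rfl⟩)
    simp only [List.map_const', List.sum_replicate, smul_eq_mul, mul_one]
    omega

variable [CharZero K]

/-- The number operator kills y, so (n+1) y lies one step lower in the degree filtration whenever y
has degree at most n + 1. In characteristic zero y descends to the scalars, where the constant term
detects it. -/
theorem eq_zero_of_annih_eq_zero {y : Fer K σ} (h0 : ExteriorAlgebra.algebraMapInv y = (0 : K))
    (h : ∀ a, annih K a y = 0) : y = 0 := by
  have hN : numberOp K y = 0 := by
    rw [numberOp, lfSum_apply]
    refine finsum_eq_zero_of_forall_eq_zero fun a => ?_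
    rw [Module.End.mul_apply, h, map_zero]
  have hdown : ∀ n : ℕ, y ∈ ferU K (fun _ => 1) n → y ∈ ferU K (fun _ => 1) 0 := by
    intro n
    induction n with
    | zero => exact fun hy => by simpa using hy
    | succ n ih =>
      intro hy
      have := numberOp_sub_mem K n (y := y) (by simpa using hy)
      rw [hN, zero_sub, Submodule.neg_mem_iff] at this
      exact ih ((Submodule.smul_mem_iff _ (by exact_mod_cast Nat.succ_ne_zero n)).1 this)
  obtain ⟨n, hn⟩ := (ferU_isWeight K (fun _ : σ => 1)).1 y
  have hy := hdown n.toNat (ferU_mono K _ (by omega) hn)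
  have hle : ferU K (fun _ : σ => 1) 0 ≤ Submodule.span K {1} := by
    refine Submodule.span_le.2 ?_
    rintro x ⟨l, hl, rfl⟩
    have : l = [] := by
      rw [← List.length_eq_zero_iff]
      simp at hl
      simpa using hl
    subst this
    exact Submodule.subset_span (by simp)
  obtain ⟨c, rfl⟩ := Submodule.mem_span_singleton.1 (hle hy)
  rw [map_smul, map_one, smul_eq_mul, mul_one] at h0
  rw [h0, zero_smul]

end Detect

/-! ### The fermionic vanishing identity -/

section Vanishing

variable {K : Type*} [Field K] [CharZero K]

omit [CharZero K] in
theorem algebraMapInv_create {σ : Type*} (a : σ) (x : Fer K σ) :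
    ExteriorAlgebra.algebraMapInv (create K a x) = (0 : K) := by
  simp [create, ExteriorAlgebra.algebraMapInv]

-- Each term of the exponent of V^{(-)} has π_k on the left, so only the leading 1 of V^{(-)} has a
-- constant term; then ⟨∅| kills every ψ† on the left in V^{(+)}. Only the power w^0 survives.
omit [CharZero K] in
theorem algebraMapInv_vferm (q t : K) {N : ℤ} (hN : N ≠ 0) (y : Fer K ℕ+) :
    ExteriorAlgebra.algebraMapInv (vferm q t N y) = (0 : K) := by
  have h1 : ∀ c d, ExteriorAlgebra.algebraMapInv (vevZ q t c d y)
      = if c = 0 then (if d = 0 then ExteriorAlgebra.algebraMapInv y else (0 : K)) else 0 := by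
    intro c d
    rw [vevZ_apply]
    have := map_zcoeff_fexp_gen (K := K) (e := fun k => 2 * (k : ℕ) - 1)
      (a := fun k => ((1 - t⁻¹) * t ^ (2 - (k : ℤ))) • (create K (Sum.inl k) * psiSum t k))
      (ExteriorAlgebra.algebraMapInv.toLinearMap ∘ₗ braVac K) (fun k v => by
        rw [LinearMap.smul_apply, map_smul, LinearMap.comp_apply, Module.End.mul_apply,
          braVac_create_inl, AlgHom.toLinearMap_apply, algebraMapInv_create, smul_zero]) c
      (zcoeff (VFp q) d (ketVac K y))
    refine Eq.trans this ?_
    congr 1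
    have h2 := map_zcoeff_fexp_gen (K := K) (e := fun k => 2 * (k : ℕ) - 1)
      (a := fun k => ((q - 1) * q ^ ((k : ℤ) - 2)) • (psiDagSum q k * annih K (Sum.inl k)))
      (braVac K) (fun k v => by
        rw [LinearMap.smul_apply, map_smul, Module.End.mul_apply, psiDagSum, LinearMap.sum_apply,
          map_sum, Finset.sum_eq_zero, smul_zero]
        intro m _
        rw [LinearMap.smul_apply, map_smul, braVac_psiDag, smul_zero]) d (ketVac K y)
    refine (congrArg ExteriorAlgebra.algebraMapInv h2).trans ?_
    split_ifs
    · rw [braVac_ketVac]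
    · rw [map_zero]
  have hf : (Function.support fun d : ℤ => vevZ q t (N + d) d y).Finite := by
    simpa using vevZ_finite q t y (fun d => N + d) 0
  have h3 := (ExteriorAlgebra.algebraMapInv (R := K) (M := ℕ+ →₀ K)).toLinearMap.toAddMonoidHom.map_finsum
    hf
  rw [vferm_apply]
  refine h3.trans ?_
  refine finsum_eq_zero_of_forall_eq_zero fun d => ?_
  refine (h1 _ _).trans ?_
  by_cases hd : d = 0
  · rw [if_neg (by omega)]
  · rw [if_neg hd, ite_self]

/-- `∑ m = 0..j-2, t^m q^{j-2-m}`. -/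
noncomputable def hSum (q t : K) (j : ℕ) : K :=
  ∑ m ∈ Finset.range (j - 1), t ^ m * q ^ (j - 2 - m)

omit [CharZero K] in
theorem mul_pairSum_of_le {q t : K} (hq : q ≠ 0) {l j : ℕ} (h : j ≤ l) :
    q ^ ((j : ℤ) - 2) * pairSum q t l j = hSum q t j := by
  rw [pairSum, hSum, min_eq_right h, Finset.mul_sum]
  refine Finset.sum_congr rfl fun m hm => ?_
  rw [Finset.mem_range] at hm
  rw [← zpow_natCast q, mul_left_comm, ← zpow_add₀ hq]
  congr 2
  omega

omit [CharZero K] in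
/-- The rank one part of `fermMat` is the whole matrix below the diagonal. -/
theorem fermMat_of_lt {q t : K} (hq : q ≠ 0) {l j : ℕ} (h : j < l) :
    fermMat q t l j = (1 - t⁻¹) * t ^ (2 - (l : ℤ)) * (q - 1) * hSum q t j := by
  rw [fermMat, if_neg (by omega), zero_add, ← mul_pairSum_of_le hq h.le]
  ring

/-- Induction on fermionic degree, shifted by one so that n = 0 means y = 0. All N ≥ -2 are treated
at once because the inductive step raises N. -/
theorem sum_vferm_annih_annih {q t : K} (hq : q ≠ 0) {S : Finset ℕ+} (n : ℕ) :
    ∀ {y : Fer K ℕ+}, y ∈ ferU K (fun _ => 1) ((n : ℤ) - 1) → (∀ j ∉ S, annih K j y = 0) →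
    ∀ {N : ℤ}, -2 ≤ N →
    ∑ j ∈ S, ∑ k ∈ S, (hSum q t j * q ^ (k : ℕ)) •
      vferm q t (2 * (j + k) + N) (annih K j (annih K k y)) = 0 := by
  induction n with
  | zero =>
    intro y hy _ N _
    rw [(ferU_isWeight K _).2 _ (by omega), Submodule.mem_bot] at hy
    subst hy
    simp
  | succ n ih =>
    intro y hy hS N hN
    have hS' : ∀ k, ∀ j ∉ S, annih K j (annih K k y) = 0 := by
      intro k j hj
      rw [annih_annih, hS j hj, map_zero, neg_zero]
    have hS'' : ∀ i k, ∀ j ∉ S, annih K j (annih K i (annih K k y)) = 0 := by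
      intro i k j hj
      rw [annih_annih, hS' k j hj, map_zero, neg_zero]
    apply eq_zero_of_annih_eq_zero
    · rw [map_sum]
      refine Finset.sum_eq_zero fun j _ => ?_
      rw [map_sum]
      refine Finset.sum_eq_zero fun k _ => ?_
      -- As j, k ≥ 1 and N ≥ -2, the mode 2(j+k) + N is at least 2, so there is no constant term.
      rw [map_smul, algebraMapInv_vferm, smul_zero]
      have := j.pos
      have := k.pos
      omega
    · intro l
      simp only [map_sum, map_smul, annih_vferm q t l _ (hS'' _ _)]
      -- The row factor of the rank one matrix that `fermMat` equals below the diagonal. Subtracting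
      -- it everywhere leaves entries with i ≥ l only.
      set κ : K := (1 - t⁻¹) * t ^ (2 - (l : ℤ)) * (q - 1) with hκ
      have hsplit : ∀ i : ℕ+, fermMat q t l i = (fermMat q t l i - κ * hSum q t i) + κ * hSum q t i :=
        fun i => by ring
      have h1 : ∑ i ∈ S, (fermMat q t l i - κ * hSum q t i) • ∑ j ∈ S, ∑ k ∈ S,
          (hSum q t j * q ^ (k : ℕ)) • vferm q t (2 * (j + k) + (N + 2 * (i - l)))
            (annih K j (annih K k (annih K i y))) = 0 := by
        refine Finset.sum_eq_zero fun i _ => ?_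
        rcases lt_or_ge (i : ℕ) l with hi | hi
        · rw [fermMat_of_lt hq hi, ← hκ, sub_self, zero_smul]
        · rw [ih ?_ (hS' i) (by omega), smul_zero]
          have := annih_mem_ferU K (fun _ => 1) i _ _ hy
          refine ferU_mono K _ ?_ this
          push_cast
          omega
      have h2 : ∑ k ∈ S, ∑ i ∈ S, ∑ j ∈ S, (κ * q ^ (k : ℕ) * (hSum q t i * hSum q t j)) •
          vferm q t (2 * (i + j + k) + N - 2 * l) (annih K i (annih K j (annih K k y))) = 0 := by
        refine Finset.sum_eq_zero fun k _ => ?_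
        refine sum_sum_eq_zero_of_antisymm (K := K) S _ fun i _ j _ => ?_
        rw [annih_annih, map_neg, smul_neg, mul_comm (hSum q t i), add_comm (i : ℤ)]
      rw [← add_zero (0 : Fer K ℕ+)]
      nth_rw 1 [← h1]
      rw [← h2]
      simp only [Finset.smul_sum]
      rw [Finset.sum_comm (s := S) (t := S) (f := fun k i => ∑ j ∈ S, (κ * q ^ (k : ℕ) * (hSum q t i * hSum q t j)) •
          vferm q t (2 * (i + j + k) + N - 2 * l) (annih K i (annih K j (annih K k y))))]
      have h3 : ∀ j ∈ S, ∑ k ∈ S, ∑ i ∈ S, (hSum q t j * q ^ (k : ℕ)) • fermMat q t l i •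
          vferm q t (2 * (j + k) + N - 2 * l + 2 * i) (annih K i (annih K j (annih K k y)))
          = ∑ i ∈ S, ∑ k ∈ S, (hSum q t j * q ^ (k : ℕ)) • fermMat q t l i •
          vferm q t (2 * (j + k) + N - 2 * l + 2 * i) (annih K i (annih K j (annih K k y))) :=
        fun j _ => Finset.sum_comm
      rw [Finset.sum_congr rfl h3, Finset.sum_comm, ← Finset.sum_add_distrib]
      refine Finset.sum_congr rfl fun i _ => ?_
      rw [Finset.sum_comm (s := S) (t := S) (f := fun k j => (κ * q ^ (k : ℕ) * (hSum q t i * hSum q t j)) •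
          vferm q t (2 * (i + j + k) + N - 2 * l) (annih K i (annih K j (annih K k y)))),
        ← Finset.sum_add_distrib]
      refine Finset.sum_congr rfl fun j _ => ?_
      rw [← Finset.sum_add_distrib]
      refine Finset.sum_congr rfl fun k _ => ?_
      -- A cyclic permutation of three odd derivatives is even, so no sign appears.
      have e1 : annih K j (annih K k (annih K i y)) = annih K i (annih K j (annih K k y)) := by
        rw [annih_annih K k i, map_neg, annih_annih K j i, neg_neg]
      have e2 : 2 * ((j : ℤ) + k) + (N + 2 * (i - l)) = 2 * (j + k) + N - 2 * l + 2 * i := by ring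
      have e3 : 2 * ((i : ℤ) + j + k) + N - 2 * l = 2 * (j + k) + N - 2 * l + 2 * i := by ring
      rw [e1, e2, e3, smul_smul, smul_smul, ← add_smul]
      congr 1
      ring

end Vanishing

/-! ### Newton recursions and the exchange series -/

open Finset.HasAntidiagonal in
theorem sum_antidiagonal_assoc {M : Type*} [AddCommMonoid M] (f : ℕ → ℕ → ℕ → M) (n : ℕ) :
    ∑ p ∈ antidiagonal n, ∑ r ∈ antidiagonal p.2, f p.1 r.1 r.2
      = ∑ p ∈ antidiagonal n, ∑ r ∈ antidiagonal p.1, f r.1 r.2 p.2 := by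
  rw [Finset.sum_sigma', Finset.sum_sigma']
  refine Finset.sum_nbij' (fun x => ⟨(x.1.1 + x.2.1, x.2.2), (x.1.1, x.2.1)⟩)
    (fun x => ⟨(x.2.1, x.2.2 + x.1.2), (x.2.2, x.1.2)⟩) ?_ ?_ ?_ ?_ ?_
  · rintro ⟨⟨a, b⟩, ⟨c, d⟩⟩ h
    simp only [Finset.mem_sigma, mem_antidiagonal] at h ⊢
    grind
  · rintro ⟨⟨a, b⟩, ⟨c, d⟩⟩ h
    simp only [Finset.mem_sigma, mem_antidiagonal] at h ⊢
    grind
  · rintro ⟨⟨a, b⟩, ⟨c, d⟩⟩ h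
    simp only [Finset.mem_sigma, mem_antidiagonal] at h ⊢
    obtain ⟨h1, h2⟩ := h
    subst h2; rfl
  · rintro ⟨⟨a, b⟩, ⟨c, d⟩⟩ h
    simp only [Finset.mem_sigma, mem_antidiagonal] at h ⊢
    obtain ⟨h1, h2⟩ := h
    subst h2; rfl
  · rintro ⟨⟨a, b⟩, ⟨c, d⟩⟩ h
    rfl

open Finset.HasAntidiagonal in
theorem sum_antidiagonal_left_comm {M : Type*} [AddCommMonoid M] (f : ℕ → ℕ → ℕ → M) (n : ℕ) :
    ∑ p ∈ antidiagonal n, ∑ r ∈ antidiagonal p.2, f p.1 r.1 r.2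
      = ∑ p ∈ antidiagonal n, ∑ r ∈ antidiagonal p.2, f r.1 p.1 r.2 := by
  rw [sum_antidiagonal_assoc, sum_antidiagonal_assoc (fun a b c => f b a c)]
  refine Finset.sum_congr rfl fun p _ => ?_
  exact (Finset.Nat.sum_antidiagonal_swap (f := fun r : ℕ × ℕ => f r.1 r.2 p.2)).symm

section Newton

variable {K : Type*} [Field K] [CharZero K]

-- In characteristic zero this recursion determines the coefficients of F from those of its
-- logarithm L, so exchange relations can be proved by induction without composing exponentials.
open Finset.HasAntidiagonal in
theorem newton_of_derivative {A : Type*} [CommRing A] {F L : PowerSeries A}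
    (h : PowerSeries.derivative A F = PowerSeries.derivative A L * F) (n : ℕ) :
    (n : A) * PowerSeries.coeff n F
      = ∑ p ∈ antidiagonal n, (p.1 * PowerSeries.coeff p.1 L) * PowerSeries.coeff p.2 F := by
  cases n with
  | zero => simp
  | succ n =>
    have := congrArg (PowerSeries.coeff n) h
    rw [PowerSeries.coeff_derivative, PowerSeries.coeff_mul] at this
    rw [Finset.Nat.sum_antidiagonal_succ]
    simp only [Nat.cast_zero, zero_mul, zero_add]
    rw [mul_comm, Nat.cast_add_one, this]
    refine Finset.sum_congr rfl fun p _ => ?_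
    rw [PowerSeries.coeff_derivative, Nat.cast_add_one, mul_comm (p.1 + 1 : A)]

/-- `(1 - t^r) p_r`, and zero for `r = 0`. -/
noncomputable def cStep (t : K) (r : ℕ) : Bos K :=
  if h : 0 < r then (1 - t ^ r) • (MvPolynomial.X (⟨r, h⟩ : ℕ+) : Bos K) else 0

omit [CharZero K] in
theorem cStep_zero (t : K) : cStep t 0 = 0 := by
  simp [cStep]

omit [CharZero K] in
theorem cStep_coe (t : K) (k : ℕ+) :
    cStep t k = (1 - t ^ (k : ℕ)) • (MvPolynomial.X k : Bos K) := by
  rw [cStep, dif_pos k.pos]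
  rfl

theorem exists_pnat_of_pos {r : ℕ} (h : 0 < r) : ∃ k : ℕ+, (k : ℕ) = r := ⟨⟨r, h⟩, rfl⟩

theorem coeff_gen_id {A : Type*} [Ring A] (a : ℕ+ → A) (r : ℕ+) :
    PowerSeries.coeff (r : ℕ) (gen (fun k => (k : ℕ)) a) = a r := by
  rw [coeff_gen (fun _ => le_rfl) a (S := Finset.Iic r) fun k hk => by simpa using hk,
    Finset.sum_eq_single r]
  · simp
  · intro b _ hb
    exact if_neg fun hbr => hb (PNat.coe_injective hbr)
  · simp

open Finset.HasAntidiagonal in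
theorem newton_cPoly (t : K) (n : ℕ) :
    (n : K) • cPoly t n = ∑ p ∈ antidiagonal n, cStep t p.1 * cPoly t p.2 := by
  have := newton_of_derivative (derivative_fexp (K := K) (coeff_zero_gen (e := fun r => (r : ℕ))
    fun r => ((1 - t ^ (r : ℕ)) / (r : ℕ)) • (MvPolynomial.X r : Bos K))) n
  have h2 : (n : K) • cPoly t n = (n : Bos K) * cPoly t n := by
    rw [Algebra.smul_def, map_natCast]
  rw [h2]
  refine this.trans (Finset.sum_congr rfl fun p _ => ?_)
  congr 1
  rcases Nat.eq_zero_or_pos p.1 with h | h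
  · rw [h, cStep_zero, Nat.cast_zero, zero_mul]
  · obtain ⟨k, hk⟩ := exists_pnat_of_pos h
    have h0 : (k : K) ≠ 0 := by exact_mod_cast k.ne_zero
    rw [← hk, coeff_gen_id, cStep_coe, ← map_natCast (algebraMap K (Bos K)), ← Algebra.smul_def,
      smul_smul]
    congr 1
    field_simp

omit [CharZero K] in
theorem cPoly_zero (t : K) : cPoly t 0 = 1 := coeff_zero_fexp _

/-- `∑ a^n x^n`. -/
noncomputable def geomSeries (a : K) : PowerSeries K := PowerSeries.mk fun n => a ^ n

omit [CharZero K] in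
theorem one_sub_mul_geomSeries (a : K) :
    (1 - PowerSeries.C a * PowerSeries.X) * geomSeries a = 1 := by
  ext n
  rw [sub_mul, one_mul, map_sub, mul_assoc, PowerSeries.coeff_C_mul]
  cases n with
  | zero => simp [geomSeries]
  | succ n => rw [PowerSeries.coeff_succ_X_mul]; simp [geomSeries, pow_succ']

/-- `(1 - x)(1 - q t x) / ((1 - q x)(1 - t x))`, the function that arises when the bosonic vertex
operator is moved through `∑ c_n x^n`. -/
noncomputable def exchangeSeries (q t : K) : PowerSeries K :=
  1 - PowerSeries.C ((1 - q) * (1 - t)) * (PowerSeries.X * (geomSeries q * geomSeries t))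

omit [CharZero K] in
theorem derivative_geomSeries (a : K) :
    PowerSeries.derivative K (geomSeries a) = PowerSeries.C a * geomSeries a ^ 2 := by
  have h := congrArg (PowerSeries.derivative K) (one_sub_mul_geomSeries a)
  rw [Derivation.leibniz, PowerSeries.derivative_one] at h
  simp only [smul_eq_mul, map_sub, PowerSeries.derivative_one, Derivation.leibniz,
    PowerSeries.derivative_C, PowerSeries.derivative_X] at h
  have h1 := one_sub_mul_geomSeries a
  linear_combination (geomSeries a) * h - (PowerSeries.derivative K (geomSeries a)
    ) * h1

/-- The logarithmic derivative of `exchangeSeries`. -/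
noncomputable def exchangeLog (q t : K) : PowerSeries K :=
  PowerSeries.mk fun n => (1 - t ^ n) * (q ^ n - 1) / n

/-- Since (1-t^n)(q^n-1) = q^n - 1 - (qt)^n + t^n, the logarithm splits into four logarithms of
linear factors. -/
theorem derivative_exchangeSeries (q t : K) :
    PowerSeries.derivative K (exchangeSeries q t)
      = PowerSeries.derivative K (exchangeLog q t) * exchangeSeries q t := by
  have hL : PowerSeries.derivative K (exchangeLog q t) = PowerSeries.C q * geomSeries q
      - geomSeries 1 - PowerSeries.C (q * t) * geomSeries (q * t)
      + PowerSeries.C t * geomSeries t := by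
    ext n
    have h0 : ((n : K) + 1) ≠ 0 := by exact_mod_cast Nat.succ_ne_zero n
    rw [PowerSeries.coeff_derivative]
    simp only [exchangeLog, geomSeries, PowerSeries.coeff_mk, map_add, map_sub,
      PowerSeries.coeff_C_mul]
    push_cast
    field_simp
    ring
  have h1 := one_sub_mul_geomSeries (1 : K)
  have hq := one_sub_mul_geomSeries q
  have ht := one_sub_mul_geomSeries t
  have hqt := one_sub_mul_geomSeries (q * t)
  -- This is (1-qx)(1-tx) - (1-q)(1-t)x = (1-x)(1-qtx).
  have hG : exchangeSeries q t = (1 - PowerSeries.C 1 * PowerSeries.X)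
      * (1 - PowerSeries.C (q * t) * PowerSeries.X) * (geomSeries q * geomSeries t) := by
    rw [exchangeSeries]
    simp only [map_mul, map_sub, map_one] at *
    linear_combination (-(1 - PowerSeries.C t * PowerSeries.X) * geomSeries t) * hq - ht
  rw [hL, hG]
  simp only [Derivation.leibniz, derivative_geomSeries, map_sub, PowerSeries.derivative_one,
    PowerSeries.derivative_C, PowerSeries.derivative_X, smul_eq_mul]
  simp only [map_mul, map_one, one_mul] at *
  linear_combination ((1 - PowerSeries.C q * PowerSeries.C t * PowerSeries.X)
      * (geomSeries q * geomSeries t)) * h1 + (PowerSeries.C q * PowerSeries.C t *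
      (1 - PowerSeries.X) * (geomSeries q * geomSeries t)) * hqt

/-- The coefficients of `exchangeSeries`. -/
noncomputable def exchange (q t : K) (n : ℕ) : K := PowerSeries.coeff n (exchangeSeries q t)

omit [CharZero K] in
theorem exchange_zero (q t : K) : exchange q t 0 = 1 := by
  simp [exchange, exchangeSeries]

omit [CharZero K] in
open Finset.HasAntidiagonal in
theorem exchange_succ (q t : K) (n : ℕ) : exchange q t (n + 1)
    = -((1 - q) * (1 - t)) * ∑ p ∈ antidiagonal n, q ^ p.1 * t ^ p.2 := by
  rw [exchange, exchangeSeries, map_sub, PowerSeries.coeff_C_mul, PowerSeries.coeff_succ_X_mul,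
    PowerSeries.coeff_mul]
  simp [geomSeries, PowerSeries.coeff_one]

open Finset.HasAntidiagonal in
theorem newton_exchange (q t : K) (n : ℕ) : (n : K) * exchange q t n
    = ∑ p ∈ antidiagonal n, ((1 - t ^ p.1) * (q ^ p.1 - 1)) * exchange q t p.2 := by
  refine (newton_of_derivative (derivative_exchangeSeries q t) n).trans
    (Finset.sum_congr rfl fun p _ => ?_)
  rw [exchange]
  congr 1
  rw [exchangeLog, PowerSeries.coeff_mk]
  rcases Nat.eq_zero_or_pos p.1 with h | h
  · simp [h]
  · have h0 : (p.1 : K) ≠ 0 := by exact_mod_cast h.ne'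
    field_simp

end Newton

/-! ### Moving c_n through V_B^{(+)} -/

section Bosonic

variable {K : Type*} [Field K] [CharZero K]

theorem zcoeff_VBp_X_mul (q : K) (r : ℕ+) (n : ℤ) (f : Bos K) :
    zcoeff (VBp q) n (MvPolynomial.X r * f) = MvPolynomial.X r * zcoeff (VBp q) n f
      + (q ^ (r : ℕ) - 1) • zcoeff (VBp q) (n - 2 * r) f := by
  classical
  have hf : {k : ℕ+ | ((2 * (k : ℕ) : ℕ) : ℤ) ≤ n}.Finite := by
    refine Set.Finite.subset (((Set.finite_Iic n.toNat).preimage PNat.coe_injective.injOn)) ?_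
    intro k hk
    simp only [Set.mem_preimage, Set.mem_Iic, Set.mem_ofPred_eq] at hk ⊢
    omega
  have key := End.mul_zcoeff_fexp_gen (K := K) (e := fun k => 2 * (k : ℕ)) (fun k => by omega)
    (D := LinearMap.mulLeft K (MvPolynomial.X r : Bos K)) (a := fun k => (q ^ (k : ℕ) - 1) • dp K k)
    -- The sign is that of [p_r, ∂/∂p_r] = -1; solving for V_B^{(+)} p_r makes it positive again.
    (b := fun k => if k = r then (-(q ^ (k : ℕ) - 1)) • (1 : Module.End K (Bos K)) else 0)
    (S := insert r hf.toFinset) (n := n) ?_ ?_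
    (fun k hk => Finset.mem_insert_of_mem (by simpa using hk))
  · have := LinearMap.congr_fun key f
    simp only [mul_ite, mul_zero] at this
    rw [Finset.sum_ite_eq', if_pos (by simp), mul_smul_comm, mul_one] at this
    simp only [Module.End.mul_apply, LinearMap.add_apply, LinearMap.smul_apply,
      LinearMap.mulLeft_apply] at this
    change _ = zcoeff (VBp q) n _ + _ • zcoeff (VBp q) _ _ at this
    change MvPolynomial.X r * zcoeff (VBp q) n f = _ at this
    rw [this]
    push_cast
    module
  · intro k
    apply LinearMap.ext
    intro g
    simp only [Module.End.mul_apply, LinearMap.add_apply, LinearMap.smul_apply, dp,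
      LinearMap.mulLeft_apply]
    change _ * (_ • MvPolynomial.pderiv k g) = _ • MvPolynomial.pderiv k _ + _
    rw [Derivation.leibniz, MvPolynomial.pderiv_X]
    by_cases h : k = r
    · subst h
      simp only [Pi.single_eq_same, if_true, LinearMap.smul_apply, Module.End.one_apply,
        smul_eq_mul, mul_one, mul_smul_comm]
      module
    · simp [h, Ne.symm h]
  · intro k l
    split_ifs
    · exact (Commute.one_right _).smul_right _
    · exact Commute.zero_right _

theorem zcoeff_VBp_cStep_mul (q t : K) (r : ℕ) (n : ℤ) (f : Bos K) :
    zcoeff (VBp q) n (cStep t r * f) = cStep t r * zcoeff (VBp q) n f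
      + ((1 - t ^ r) * (q ^ r - 1)) • zcoeff (VBp q) (n - 2 * r) f := by
  rcases Nat.eq_zero_or_pos r with rfl | h
  · simp [cStep_zero]
  · obtain ⟨k, rfl⟩ := exists_pnat_of_pos h
    rw [cStep_coe, smul_mul_assoc, map_smul, zcoeff_VBp_X_mul, smul_add, smul_smul, smul_mul_assoc]

-- The shift of the p_r by V_B^{(+)} multiplies ∑ c_n z^n by the exchange series at z w^{-2}. Both
-- factors obey Newton recursions, and strong induction compares n times the two sides.
open Finset.HasAntidiagonal in
theorem zcoeff_VBp_cPoly_mul (q t : K) (n : ℕ) : ∀ (b : ℤ) (f : Bos K),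
    zcoeff (VBp q) b (cPoly t n * f) = ∑ p ∈ antidiagonal n,
      exchange q t p.1 • (cPoly t p.2 * zcoeff (VBp q) (b - 2 * p.1) f) := by
  induction n using Nat.strong_induction_on with
  | _ n ih =>
    intro b f
    rcases Nat.eq_zero_or_pos n with rfl | hn
    · simp [cPoly_zero, exchange_zero]
    have h0 : (n : K) ≠ 0 := by exact_mod_cast hn.ne'
    refine (smul_right_injective _ h0).eq_iff.1 ?_
    rw [← map_smul, ← smul_mul_assoc, newton_cPoly, Finset.sum_mul, map_sum]
    have h1 : ∀ p ∈ antidiagonal n, zcoeff (VBp q) b (cStep t p.1 * cPoly t p.2 * f)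
        = ∑ r ∈ antidiagonal p.2, (exchange q t r.1 • (cStep t p.1 * cPoly t r.2 *
            zcoeff (VBp q) (b - 2 * r.1) f)
          + (((1 - t ^ p.1) * (q ^ p.1 - 1)) * exchange q t r.1) • (cPoly t r.2 *
            zcoeff (VBp q) (b - 2 * (p.1 + r.1)) f)) := by
      intro p hp
      have hp' : p.1 + p.2 = n := by simpa using hp
      rw [mul_assoc, zcoeff_VBp_cStep_mul]
      rcases Nat.eq_zero_or_pos p.1 with h | h
      · simp [h, cStep_zero]
      · rw [ih p.2 (by omega), ih p.2 (by omega), Finset.mul_sum, Finset.smul_sum,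
          ← Finset.sum_add_distrib]
        refine Finset.sum_congr rfl fun r _ => ?_
        have e : b - 2 * (p.1 : ℤ) - 2 * r.1 = b - 2 * (p.1 + r.1) := by ring
        rw [mul_smul_comm, smul_smul, mul_assoc (cStep t p.1), e]
    rw [Finset.sum_congr rfl h1]
    simp only [Finset.sum_add_distrib]
    rw [sum_antidiagonal_left_comm (fun x y z => exchange q t y • (cStep t x * cPoly t z *
            zcoeff (VBp q) (b - 2 * y) f)),
      sum_antidiagonal_assoc (fun x y z => (((1 - t ^ x) * (q ^ x - 1)) * exchange q t y) •
        (cPoly t z * zcoeff (VBp q) (b - 2 * (x + y)) f)), ← Finset.sum_add_distrib,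
      Finset.smul_sum]
    refine Finset.sum_congr rfl fun p hp => ?_
    have hp' : p.1 + p.2 = n := by simpa using hp
    -- The factor n = p.1 + p.2 comes in two pieces: the recursion for c gives p.2, and that for the
    -- exchange coefficients gives p.1.
    have h2 : ∑ r ∈ antidiagonal p.2, exchange q t p.1 • (cStep t r.1 * cPoly t r.2 *
        zcoeff (VBp q) (b - 2 * p.1) f)
        = ((p.2 : K) * exchange q t p.1) • (cPoly t p.2 * zcoeff (VBp q) (b - 2 * p.1) f) := by
      rw [← Finset.smul_sum, ← Finset.sum_mul, ← newton_cPoly, smul_mul_assoc, smul_smul, mul_comm]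
    have h3 : ∑ r ∈ antidiagonal p.1, (((1 - t ^ r.1) * (q ^ r.1 - 1)) * exchange q t r.2) •
        (cPoly t p.2 * zcoeff (VBp q) (b - 2 * (r.1 + r.2)) f)
        = ((p.1 : K) * exchange q t p.1) • (cPoly t p.2 * zcoeff (VBp q) (b - 2 * p.1) f) := by
      rw [newton_exchange, Finset.sum_smul]
      refine Finset.sum_congr rfl fun r hr => ?_
      have hr' : r.1 + r.2 = p.1 := by simpa using hr
      rw [← hr']
      push_cast
      rfl
    rw [h2, h3, ← add_smul, smul_smul, ← add_mul, ← hp']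
    push_cast
    rw [add_comm]

end Bosonic

/-! ### Exponentials under algebra maps and under x ↦ a x² -/

section Dilation

variable {K : Type*} [Field K]

theorem coeff_fexp_gen_map {A B : Type*} [Ring A] [Ring B] [Algebra K A] [Algebra K B]
    (φ : A →ₐ[K] B) (e : ℕ+ → ℕ) (a : ℕ+ → A) (n : ℕ) :
    PowerSeries.coeff n (fexp K (gen e fun k => φ (a k)))
      = φ (PowerSeries.coeff n (fexp K (gen e a))) := by
  have h : gen e (fun k => φ (a k)) = PowerSeries.map (φ : A →+* B) (gen e a) := by
    ext j
    rw [PowerSeries.coeff_map, gen, gen, PowerSeries.coeff_mk, PowerSeries.coeff_mk, map_sum]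
    refine Finset.sum_congr rfl fun i _ => ?_
    split_ifs
    · rfl
    · rw [map_zero]
  rw [h, fexp, fexp, PowerSeries.coeff_mk, PowerSeries.coeff_mk, map_sum]
  refine Finset.sum_congr rfl fun m _ => ?_
  rw [← map_pow, PowerSeries.coeff_map, map_smul]
  rfl

variable {A : Type*} [CommRing A] [Algebra K A]

theorem coeff_fexp_expand_rescale {X : PowerSeries A} (h0 : PowerSeries.coeff 0 X = 0) (a : A)
    (n : ℕ) : PowerSeries.coeff n (fexp K (PowerSeries.expand 2 two_ne_zero (PowerSeries.rescale a X)))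
      = if 2 ∣ n then a ^ (n / 2) * PowerSeries.coeff (n / 2) (fexp K X) else 0 := by
  rw [fexp, PowerSeries.coeff_mk]
  have h : ∀ m, PowerSeries.coeff n ((PowerSeries.expand 2 two_ne_zero (PowerSeries.rescale a X)) ^ m)
      = if 2 ∣ n then a ^ (n / 2) * PowerSeries.coeff (n / 2) (X ^ m) else 0 := by
    intro m
    rw [← map_pow, ← map_pow, PowerSeries.coeff_expand, PowerSeries.coeff_rescale]
  simp only [h]
  split_ifs
  · rw [coeff_fexp_eq_truncExp K h0 (show n / 2 < n + 1 by omega), truncExp, map_sum, Finset.mul_sum]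
    refine Finset.sum_congr rfl fun m _ => ?_
    rw [PowerSeries.coeff_smul, mul_smul_comm]
  · simp

/-- Any sufficiently large `m` is allowed: further terms involve negative powers in `G`. This lets
sums for different modes share one range. -/
theorem zcoeff_mul_of_even {F G : PowerSeries A} (hF : ∀ n, ¬ 2 ∣ n → PowerSeries.coeff n F = 0)
    {L : ℤ} {m : ℕ} (hm : L < 2 * m) :
    zcoeff (F * G) L = ∑ a ∈ Finset.range m, PowerSeries.coeff (2 * a) F * zcoeff G (L - 2 * a) := by
  rcases lt_or_ge L 0 with hL | hL
  · rw [zcoeff_neg _ hL, Finset.sum_eq_zero]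
    intro a _
    rw [zcoeff_neg _ (by omega), mul_zero]
  lift L to ℕ using hL
  rw [zcoeff_natCast, PowerSeries.coeff_mul,
    Finset.Nat.sum_antidiagonal_eq_sum_range_succ (fun i j => PowerSeries.coeff i F *
      PowerSeries.coeff j G)]
  have h1 : ∀ k ∈ Finset.range L.succ, PowerSeries.coeff k F * PowerSeries.coeff (L - k) G
      = PowerSeries.coeff k F * zcoeff G ((L : ℤ) - k) := by
    intro k hk
    rw [Finset.mem_range] at hk
    have e : (L : ℤ) - k = ((L - k : ℕ) : ℤ) := by omega
    rw [e, zcoeff_natCast]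
  rw [Finset.sum_congr rfl h1]
  have h2 : Finset.range L.succ ⊆ Finset.range (2 * m) := by
    intro x
    simp only [Finset.mem_range]
    omega
  rw [Finset.sum_subset h2 fun k _ hk => ?_]
  · clear h1 h2 hm
    induction m with
    | zero => simp
    | succ m ih =>
      rw [Finset.sum_range_succ, ← ih, show 2 * (m + 1) = 2 * m + 1 + 1 by ring,
        Finset.sum_range_succ, Finset.sum_range_succ, hF (2 * m + 1) (by omega)]
      push_cast
      rw [zero_mul, add_zero]
  · rw [zcoeff_neg G, mul_zero]
    simp only [Finset.mem_range] at hk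
    omega

end Dilation

/-! ### Cancelling V_B^{(-)}, and the bosonic exchange relation -/

section Bosonic

variable {K : Type*} [Field K]

/-- `V_B^{(-)}` as a series with polynomial coefficients. -/
noncomputable def vbmPoly (t : K) : PowerSeries (Bos K) :=
  fexp K (gen (fun k => 2 * (k : ℕ)) fun k =>
    ((1 - t ^ (-(k : ℤ))) / (k : ℕ)) • (MvPolynomial.X k : Bos K))

theorem zcoeff_VBm (t : K) (n : ℤ) (f : Bos K) : zcoeff (VBm t) n f = zcoeff (vbmPoly t) n * f := by
  rw [zcoeff, zcoeff]
  split_ifs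
  · have h := coeff_fexp_gen_map (Algebra.lmul K (Bos K)) (fun k => 2 * (k : ℕ)) (fun k =>
      ((1 - t ^ (-(k : ℤ))) / (k : ℕ)) • (MvPolynomial.X k : Bos K)) n.toNat
    refine Eq.trans ?_ (LinearMap.congr_fun h f)
    simp only [map_smul]
    rfl
  · simp

theorem exists_VBp_bound (q : K) (f : Bos K) :
    ∃ B : ℤ, ∀ b : ℤ, B ≤ b → zcoeff (VBp q) b f = 0 := by
  obtain ⟨B, hB⟩ := (VBp_lowers q).exists_bound (bosU_isWeight K _) f
  refine ⟨B, fun b hb => ?_⟩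
  lift b to ℕ using by omega
  rw [zcoeff_natCast, hB b (by omega)]

theorem vbos_apply (q t : K) (N : ℤ) (f : Bos K) :
    vbos q t N f = ∑ᶠ b : ℤ, zcoeff (vbmPoly t) (N + b) * zcoeff (VBp q) b f := by
  rw [← finsum_natCast]
  · change ∑ᶠ b : ℕ, _ = _
    refine finsum_congr fun b => ?_
    rw [← zcoeff_VBm, zcoeff_natCast]
    rfl
  · intro n hn
    rw [zcoeff_neg (VBp q) hn]
    simp

theorem smul_mul_finsum {ι : Type*} {g : ι → Bos K} (hg : (Function.support g).Finite) (c : K)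
    (p : Bos K) : c • (p * ∑ᶠ b, g b) = ∑ᶠ b, c • (p * g b) :=
  map_finsum (c • LinearMap.mulLeft K p) hg

theorem vbos_finite (q : K) (f : Bos K) (e : ℤ) (h : ℤ → Bos K) :
    (Function.support fun b : ℤ => h b * zcoeff (VBp q) (b - e) f).Finite := by
  obtain ⟨B, hB⟩ := exists_VBp_bound q f
  refine (Set.finite_Ico e (B + e)).subset fun b hb => ?_
  rw [Set.mem_Ico]
  by_contra hcon
  refine hb ?_
  beta_reduce
  by_cases h : b < e
  · rw [zcoeff_neg (VBp q) (by omega)]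
    simp
  · rw [hB _ (by omega), mul_zero]

variable [CharZero K]

/-- Putting z = w²/t in ∑ c_n z^n turns (1-t^r)/r into -(1-t^{-r})/r, so that series is the inverse
of V_B^{(-)}. -/
theorem sum_cPoly_mul_vbmPoly {t : K} (ht : t ≠ 0) {L : ℤ} {m : ℕ} (hm : L < 2 * m) :
    ∑ a ∈ Finset.range m, (t⁻¹ ^ a) • (cPoly t a * zcoeff (vbmPoly t) (L - 2 * a))
      = if L = 0 then 1 else 0 := by
  set X : PowerSeries (Bos K) := gen (fun k => (k : ℕ))
    fun r => ((1 - t ^ (r : ℕ)) / (r : ℕ)) • (MvPolynomial.X r : Bos K) with hX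
  set Y : PowerSeries (Bos K) := gen (fun k => 2 * (k : ℕ)) fun k =>
    ((1 - t ^ (-(k : ℤ))) / (k : ℕ)) • (MvPolynomial.X k : Bos K) with hY
  have hXY : -Y = PowerSeries.expand 2 two_ne_zero
      (PowerSeries.rescale (algebraMap K (Bos K) t⁻¹) X) := by
    ext1 j
    rw [PowerSeries.coeff_expand, map_neg]
    have hg : ∀ r : ℕ+, PowerSeries.coeff (2 * (r : ℕ)) Y
        = ((1 - t ^ (-(r : ℤ))) / (r : ℕ)) • (MvPolynomial.X r : Bos K) := by
      intro r
      rw [hY, coeff_gen (fun k => by omega) _ (S := Finset.Iic r) fun k hk => by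
        rw [Finset.mem_Iic, ← PNat.coe_le_coe]; omega, Finset.sum_eq_single r]
      · simp
      · intro b _ hb
        refine if_neg fun hbr => hb (PNat.coe_injective ?_)
        omega
      · simp
    split_ifs with hj
    · obtain ⟨i, rfl⟩ := hj
      rw [Nat.mul_div_cancel_left _ two_pos, PowerSeries.coeff_rescale]
      rcases Nat.eq_zero_or_pos i with rfl | hi
      · rw [mul_zero, hY, hX, coeff_zero_gen, coeff_zero_gen]
        simp
      · obtain ⟨r, rfl⟩ := exists_pnat_of_pos hi
        rw [hg, hX, coeff_gen_id, ← map_pow, ← Algebra.smul_def, smul_smul, ← neg_smul]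
        congr 1
        rw [zpow_neg, zpow_natCast, inv_pow]
        have : t ^ (r : ℕ) ≠ 0 := pow_ne_zero _ ht
        field_simp
        ring
    · rw [hY, gen, PowerSeries.coeff_mk, Finset.sum_eq_zero, neg_zero]
      intro i _
      refine if_neg ?_
      omega
  have hC : ∀ n, PowerSeries.coeff n (fexp K (-Y)) = if 2 ∣ n then
      (algebraMap K (Bos K) t⁻¹) ^ (n / 2) * PowerSeries.coeff (n / 2) (fexp K X) else 0 := by
    intro n
    rw [hXY]
    exact coeff_fexp_expand_rescale (coeff_zero_gen _) _ _
  have key := zcoeff_mul_of_even (F := fexp K (-Y)) (G := fexp K Y)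
    (fun n hn => by rw [hC, if_neg hn]) hm
  rw [fexp_neg_mul_fexp (coeff_zero_gen _)] at key
  have h1 : zcoeff (1 : PowerSeries (Bos K)) L = if L = 0 then 1 else 0 := by
    rw [zcoeff, PowerSeries.coeff_one]
    split_ifs <;> first | rfl | omega
  rw [← h1, key]
  refine Finset.sum_congr rfl fun a _ => ?_
  rw [hC, if_pos (Dvd.intro _ rfl), Nat.mul_div_cancel_left _ two_pos, ← map_pow,
    ← Algebra.smul_def, smul_mul_assoc]
  rfl

open Finset.HasAntidiagonal in
theorem vbos_cPoly_mul (q t : K) (N : ℤ) (n : ℕ) (f : Bos K) :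
    vbos q t N (cPoly t n * f) = ∑ p ∈ antidiagonal n,
      exchange q t p.1 • (cPoly t p.2 * vbos q t (N + 2 * p.1) f) := by
  rw [vbos_apply]
  have h1 : ∀ b : ℤ, zcoeff (vbmPoly t) (N + b) * zcoeff (VBp q) b (cPoly t n * f)
      = ∑ p ∈ antidiagonal n, (exchange q t p.1 • (cPoly t p.2 * zcoeff (vbmPoly t) (N + b)))
        * zcoeff (VBp q) (b - 2 * p.1) f := by
    intro b
    rw [zcoeff_VBp_cPoly_mul, Finset.mul_sum]
    refine Finset.sum_congr rfl fun p _ => ?_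
    rw [mul_smul_comm, smul_mul_assoc]
    congr 1
    ring
  rw [finsum_congr h1, finsum_sum_comm _ _ fun p _ => vbos_finite q f _ _]
  refine Finset.sum_congr rfl fun p _ => ?_
  rw [vbos_apply, ← finsum_sub_right (fun b => zcoeff (vbmPoly t) (N + 2 * p.1 + b)
    * zcoeff (VBp q) b f) (2 * p.1), smul_mul_finsum (vbos_finite q f _ _)]
  refine finsum_congr fun b => ?_
  have e : N + 2 * p.1 + (b - 2 * p.1) = N + b := by ring
  rw [smul_mul_assoc, mul_assoc, e]

/-- With V_B^{(-)} cancelled only V_B^{(+)} is left; its mode is -N because it is a series in w⁻¹.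
Only b < B matters, which makes the range up to `m` long enough. -/
theorem sum_cPoly_mul_vbos {q t : K} (ht : t ≠ 0) {f : Bos K} {B : ℤ}
    (hB : ∀ b : ℤ, B ≤ b → zcoeff (VBp q) b f = 0) {N : ℤ} {m : ℕ} (hm : N + B ≤ 2 * m) :
    ∑ a ∈ Finset.range m, (t⁻¹ ^ a) • (cPoly t a * vbos q t (N - 2 * a) f)
      = zcoeff (VBp q) (-N) f := by
  have h0 : ∀ h : ℤ → Bos K, (Function.support fun b : ℤ => h b * zcoeff (VBp q) b f).Finite := by
    intro h
    simpa using vbos_finite q f 0 h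
  have h1 : ∀ a ∈ Finset.range m, (t⁻¹ ^ a) • (cPoly t a * vbos q t (N - 2 * a) f)
      = ∑ᶠ b : ℤ, (t⁻¹ ^ a) • (cPoly t a * zcoeff (vbmPoly t) (N + b - 2 * a))
        * zcoeff (VBp q) b f := by
    intro a _
    rw [vbos_apply, smul_mul_finsum (h0 _)]
    refine finsum_congr fun b => ?_
    have e : N - 2 * a + b = N + b - 2 * a := by ring
    rw [smul_mul_assoc, mul_assoc, e]
  rw [Finset.sum_congr rfl h1, ← finsum_sum_comm _ _ fun a _ => h0 _]
  rw [finsum_eq_single _ (-N)]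
  · rw [← Finset.sum_mul]
    by_cases h : B ≤ -N
    · rw [hB _ h, mul_zero]
    · rw [sum_cPoly_mul_vbmPoly ht (by omega), if_pos (by omega), one_mul]
  · intro b hb
    rw [← Finset.sum_mul]
    by_cases h : B ≤ b
    · rw [hB _ h, mul_zero]
    · rw [sum_cPoly_mul_vbmPoly ht (by omega), if_neg (by omega), zero_mul]

end Bosonic

/-! ### Exchange relations on superpolynomials -/

section FockLevel

variable {K : Type*} [Field K]

theorem dpi_tmul (k : ℕ+) (f : Bos K) (y : Fer K ℕ+) : dpi K k (f ⊗ₜ y) = f ⊗ₜ annih K k y := rfl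

theorem polyMul_tmul (g f : Bos K) (y : Fer K ℕ+) : polyMul K g (f ⊗ₜ y) = (g * f) ⊗ₜ y := rfl

theorem dpi_dpi (j k : ℕ+) (v : Fock K) : dpi K j (dpi K k v) = -dpi K k (dpi K j v) := by
  induction v using TensorProduct.induction_on with
  | zero => simp
  | tmul f y => rw [dpi_tmul, dpi_tmul, dpi_tmul, dpi_tmul, annih_annih, TensorProduct.tmul_neg]
  | add x y hx hy => simp only [map_add, hx, hy]; abel

theorem dpi_polyMul (k : ℕ+) (g : Bos K) (v : Fock K) :
    dpi K k (polyMul K g v) = polyMul K g (dpi K k v) := by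
  induction v using TensorProduct.induction_on with
  | zero => simp
  | tmul f y => rfl
  | add x y hx hy => simp only [map_add, hx, hy]

theorem exists_dpi_support (v : Fock K) : ∃ S : Finset ℕ+, ∀ j ∉ S, dpi K j v = 0 :=
  ⟨(dpi_locFin K v).toFinset, fun j hj => by simpa using hj⟩

theorem exists_annih_support (y : Fer K ℕ+) : ∃ S : Finset ℕ+, ∀ j ∉ S, annih K j y = 0 :=
  ⟨(annih_locFin K y).toFinset, fun j hj => by simpa using hj⟩

theorem vertex_tmul (q t : K) (N : ℤ) (f : Bos K) (y : Fer K ℕ+) :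
    vertex q t N (f ⊗ₜ y) = ∑ᶠ i : ℤ, vbos q t i f ⊗ₜ[K] vferm q t (N - i) y := rfl

theorem vertex_finite (q t : K) (N c : ℤ) (f : Bos K) (y : Fer K ℕ+) :
    (Function.support fun i : ℤ => vbos q t (i - c) f ⊗ₜ[K] vferm q t (N - i) y).Finite := by
  have h := vertex_locFin q t (N - c) (f ⊗ₜ y)
  refine (h.preimage ((Equiv.subRight c).injective.injOn)).subset fun i hi h0 => hi ?_
  have e : N - c - (i - c) = N - i := by ring
  change vbos q t (i - c) f ⊗ₜ[K] vferm q t (N - c - (i - c)) y = 0 at h0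
  rwa [e] at h0

theorem vertex_tmul_sub (q t : K) (N c : ℤ) (f : Bos K) (y : Fer K ℕ+) :
    vertex q t (N - c) (f ⊗ₜ y) = ∑ᶠ i : ℤ, vbos q t (i - c) f ⊗ₜ[K] vferm q t (N - i) y := by
  rw [vertex_tmul, ← finsum_sub_right _ c]
  refine finsum_congr fun i => ?_
  have e : N - c - (i - c) = N - i := by ring
  rw [e]

variable [CharZero K]

theorem dpi_vertex (q t : K) (l : ℕ+) (N : ℤ) {S : Finset ℕ+} {v : Fock K}
    (hS : ∀ j ∉ S, dpi K j v = 0) :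
    dpi K l (vertex q t N v)
      = ∑ j ∈ S, fermMat q t l j • vertex q t (N - 2 * l + 2 * j) (dpi K j v) := by
  classical
  -- Quantifying over all larger sets makes the claim additive in v, so that it can be checked on
  -- pure tensors.
  suffices H : ∀ v : Fock K, ∃ S₀ : Finset ℕ+, ∀ S ⊇ S₀, dpi K l (vertex q t N v)
      = ∑ j ∈ S, fermMat q t l j • vertex q t (N - 2 * l + 2 * j) (dpi K j v) by
    obtain ⟨S₀, h⟩ := H v
    rw [h (S₀ ∪ S) Finset.subset_union_left]
    refine (Finset.sum_subset Finset.subset_union_right fun j _ hj => ?_).symm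
    rw [hS j hj, map_zero, smul_zero]
  clear hS v
  intro v
  induction v using TensorProduct.induction_on with
  | zero => exact ⟨∅, fun S _ => by simp⟩
  | add x y hx hy =>
    obtain ⟨S1, h1⟩ := hx
    obtain ⟨S2, h2⟩ := hy
    refine ⟨S1 ∪ S2, fun S hS => ?_⟩
    simp only [map_add, smul_add, Finset.sum_add_distrib]
    rw [h1 S (Finset.subset_union_left.trans hS), h2 S (Finset.subset_union_right.trans hS)]
  | tmul f y =>
    obtain ⟨S₀, h₀⟩ := exists_annih_support y
    refine ⟨S₀, fun S hS => ?_⟩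
    have hfin : ∀ (M : ℤ) (z : Fer K ℕ+),
        (Function.support fun i : ℤ => vbos q t i f ⊗ₜ[K] vferm q t (M - i) z).Finite := by
      intro M z
      simpa using vertex_finite q t M 0 f z
    rw [vertex_tmul, map_finsum _ (hfin _ _)]
    have h1 : ∀ i : ℤ, dpi K l (vbos q t i f ⊗ₜ[K] vferm q t (N - i) y)
        = ∑ j ∈ S, fermMat q t l j • (vbos q t i f ⊗ₜ[K]
            vferm q t (N - 2 * l + 2 * j - i) (annih K j y)) := by
      intro i
      rw [dpi_tmul, annih_vferm q t l _ (fun j hj => h₀ j fun h => hj (hS h)),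
        TensorProduct.tmul_sum]
      refine Finset.sum_congr rfl fun j _ => ?_
      have e : N - i - 2 * l + 2 * j = N - 2 * l + 2 * j - i := by ring
      rw [TensorProduct.tmul_smul, e]
    rw [finsum_congr h1, finsum_sum_comm]
    · refine Finset.sum_congr rfl fun j _ => ?_
      rw [dpi_tmul, vertex_tmul, smul_finsum' _ (hfin _ _)]
    · intro j _
      refine (hfin (N - 2 * l + 2 * j) (annih K j y)).subset fun i hi h => hi ?_
      beta_reduce at h ⊢
      rw [h, smul_zero]

open Finset.HasAntidiagonal in
theorem vertex_polyMul_cPoly (q t : K) (N : ℤ) (n : ℕ) (v : Fock K) :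
    vertex q t N (polyMul K (cPoly t n) v) = ∑ p ∈ antidiagonal n,
      exchange q t p.1 • polyMul K (cPoly t p.2) (vertex q t (N + 2 * p.1) v) := by
  induction v using TensorProduct.induction_on with
  | zero => simp
  | add x y hx hy => simp only [map_add, smul_add, Finset.sum_add_distrib, hx, hy]
  | tmul f y =>
    have hfin : ∀ c : ℤ,
        (Function.support fun i : ℤ => vbos q t (i + c) f ⊗ₜ[K] vferm q t (N - i) y).Finite := by
      intro c
      simpa using vertex_finite q t N (-c) f y
    have h1 : ∀ i : ℤ, vbos q t i (cPoly t n * f) ⊗ₜ[K] vferm q t (N - i) y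
        = ∑ p ∈ antidiagonal n, (exchange q t p.1 • polyMul K (cPoly t p.2))
          (vbos q t (i + 2 * p.1) f ⊗ₜ[K] vferm q t (N - i) y) := by
      intro i
      rw [vbos_cPoly_mul, TensorProduct.sum_tmul]
      refine Finset.sum_congr rfl fun p _ => ?_
      rw [LinearMap.smul_apply, polyMul_tmul, TensorProduct.smul_tmul']
    rw [polyMul_tmul, vertex_tmul, finsum_congr h1, finsum_sum_comm]
    · refine Finset.sum_congr rfl fun p _ => ?_
      have e : N + 2 * (p.1 : ℤ) = N - (-(2 * p.1)) := by ring
      rw [← map_finsum _ (hfin _), LinearMap.smul_apply, e, vertex_tmul_sub]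
      simp only [sub_neg_eq_add]
    · intro p _
      refine (hfin (2 * p.1)).subset fun i hi h => hi ?_
      beta_reduce at h ⊢
      rw [h, map_zero]

/-- Multiplication by `∑ c_a (z/t)^a` cancels `V_B^{(-)}`. -/
theorem exists_sum_cPoly_vertex {q t : K} (ht : t ≠ 0) (N : ℤ) (f : Bos K) (y : Fer K ℕ+) :
    ∃ m₀ : ℕ, ∀ m ≥ m₀,
    ∑ a ∈ Finset.range m, (t⁻¹ ^ a) • polyMul K (cPoly t a) (vertex q t (N - 2 * a) (f ⊗ₜ y))
      = ∑ᶠ i : ℤ, zcoeff (VBp q) (-i) f ⊗ₜ[K] vferm q t (N - i) y := by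
  obtain ⟨B, hB⟩ := exists_VBp_bound q f
  obtain ⟨D, hD⟩ := exists_vferm_bound q t y
  refine ⟨(N - D + B).toNat, fun m hm => ?_⟩
  have h1 : ∀ a ∈ Finset.range m,
      (t⁻¹ ^ a) • polyMul K (cPoly t a) (vertex q t (N - 2 * a) (f ⊗ₜ y))
      = ∑ᶠ i : ℤ, (t⁻¹ ^ a • (cPoly t a * vbos q t (i - 2 * a) f)) ⊗ₜ[K] vferm q t (N - i) y := by
    intro a _
    rw [vertex_tmul_sub, ← LinearMap.smul_apply, map_finsum _ (vertex_finite q t N _ f y)]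
    refine finsum_congr fun i => ?_
    rw [LinearMap.smul_apply, polyMul_tmul, TensorProduct.smul_tmul']
  rw [Finset.sum_congr rfl h1, ← finsum_sum_comm]
  · refine finsum_congr fun i => ?_
    rw [← TensorProduct.sum_tmul]
    by_cases h : N - i < D
    · rw [hD _ h, TensorProduct.tmul_zero, TensorProduct.tmul_zero]
    · rw [sum_cPoly_mul_vbos ht hB (by omega)]
  · intro a _
    refine (vertex_finite q t N (2 * a) f y).subset fun i hi h => hi ?_
    beta_reduce at h ⊢
    have := congrArg (t⁻¹ ^ a • polyMul K (cPoly t a)) h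
    rwa [map_zero, LinearMap.smul_apply, polyMul_tmul, TensorProduct.smul_tmul'] at this

/-- This disposes of the rank one part of the anticommutator: the sum over a removes V_B^{(-)}, and
the fermionic identity kills each remaining coefficient of V_B^{(+)}. -/
theorem exists_sum_cPoly_vertex_dpi_dpi {q t : K} (hq : q ≠ 0) (ht : t ≠ 0) {S : Finset ℕ+}
    {v : Fock K} (hS : ∀ j ∉ S, dpi K j v = 0) :
    ∃ m₀ : ℕ, ∀ m ≥ m₀, ∑ j ∈ S, ∑ k ∈ S, (hSum q t j * q ^ (k : ℕ)) •
      ∑ a ∈ Finset.range m, (t⁻¹ ^ a) • polyMul K (cPoly t a)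
        (vertex q t (2 * (j + k) - 2 - 2 * a) (dpi K j (dpi K k v))) = 0 := by
  classical
  suffices H : ∀ v : Fock K, ∃ S₀ : Finset ℕ+, ∀ S ⊇ S₀, ∃ m₀ : ℕ, ∀ m ≥ m₀,
      ∑ j ∈ S, ∑ k ∈ S, (hSum q t j * q ^ (k : ℕ)) •
      ∑ a ∈ Finset.range m, (t⁻¹ ^ a) • polyMul K (cPoly t a)
        (vertex q t (2 * (j + k) - 2 - 2 * a) (dpi K j (dpi K k v))) = 0 by
    obtain ⟨S₀, h⟩ := H v
    obtain ⟨m₀, h⟩ := h (S₀ ∪ S) Finset.subset_union_left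
    refine ⟨m₀, fun m hm => ?_⟩
    rw [← h m hm]
    refine (Finset.sum_subset Finset.subset_union_right fun j _ hj => ?_).trans
      (Finset.sum_congr rfl fun j _ => Finset.sum_subset Finset.subset_union_right fun k _ hk => ?_)
    · refine Finset.sum_eq_zero fun k _ => ?_
      rw [dpi_dpi, hS j hj]
      simp
    · rw [hS k hk]
      simp
  clear hS v
  intro v
  induction v using TensorProduct.induction_on with
  | zero => exact ⟨∅, fun S _ => ⟨0, fun m _ => by simp⟩⟩
  | add x y hx hy =>
    obtain ⟨S1, h1⟩ := hx
    obtain ⟨S2, h2⟩ := hy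
    refine ⟨S1 ∪ S2, fun S hS => ?_⟩
    obtain ⟨m1, h1⟩ := h1 S (Finset.subset_union_left.trans hS)
    obtain ⟨m2, h2⟩ := h2 S (Finset.subset_union_right.trans hS)
    refine ⟨max m1 m2, fun m hm => ?_⟩
    simp only [map_add, smul_add, Finset.sum_add_distrib]
    rw [h1 m ((le_max_left _ _).trans hm), h2 m ((le_max_right _ _).trans hm), add_zero]
  | tmul f y =>
    obtain ⟨S₀, h₀⟩ := exists_annih_support y
    refine ⟨S₀, fun S hS => ?_⟩
    choose m₁ hm₁ using fun p : ℕ+ × ℕ+ => exists_sum_cPoly_vertex (q := q) ht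
      (2 * ((p.1 : ℤ) + p.2) - 2) f (annih K p.1 (annih K p.2 y))
    refine ⟨(S ×ˢ S).sup m₁, fun m hm => ?_⟩
    obtain ⟨B, hB⟩ := exists_VBp_bound q f
    have hfin : ∀ (h : ℤ → Fer K ℕ+),
        (Function.support fun i : ℤ => zcoeff (VBp q) (-i) f ⊗ₜ[K] h i).Finite := by
      intro h
      refine (Set.finite_Icc (-B) 0).subset fun i hi => ?_
      rw [Set.mem_Icc]
      by_contra hcon
      refine hi ?_
      beta_reduce
      by_cases h : B ≤ -i
      · rw [hB _ h, TensorProduct.zero_tmul]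
      · rw [zcoeff_neg (VBp q) (by omega), LinearMap.zero_apply, TensorProduct.zero_tmul]
    rw [← Finset.sum_product' (f := fun j k : ℕ+ => (hSum q t j * q ^ (k : ℕ)) •
      ∑ a ∈ Finset.range m, (t⁻¹ ^ a) • polyMul K (cPoly t a)
        (vertex q t (2 * (j + k) - 2 - 2 * a) (dpi K j (dpi K k (f ⊗ₜ y)))))]
    have h1 : ∀ p ∈ S ×ˢ S, (hSum q t p.1 * q ^ (p.2 : ℕ)) •
        ∑ a ∈ Finset.range m, (t⁻¹ ^ a) • polyMul K (cPoly t a)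
          (vertex q t (2 * (p.1 + p.2) - 2 - 2 * a) (dpi K p.1 (dpi K p.2 (f ⊗ₜ y))))
        = ∑ᶠ i : ℤ, zcoeff (VBp q) (-i) f ⊗ₜ[K] ((hSum q t p.1 * q ^ (p.2 : ℕ)) •
          vferm q t (2 * (p.1 + p.2) - 2 - i) (annih K p.1 (annih K p.2 y))) := by
      intro p hp
      simp only [dpi_tmul]
      rw [hm₁ p m ((Finset.le_sup hp).trans hm), smul_finsum' _ (hfin _)]
      refine finsum_congr fun i => ?_
      rw [TensorProduct.tmul_smul]
    rw [Finset.sum_congr rfl h1, ← finsum_sum_comm _ _ fun p _ => hfin _]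
    refine finsum_eq_zero_of_forall_eq_zero fun i => ?_
    rw [← TensorProduct.tmul_sum]
    -- V_B^{(+)} has only nonpositive powers w^i, so the fermionic mode is 2(j+k) + N with N = -2 -
    -- i ≥ -2, exactly the range covered.
    rcases lt_or_ge 0 i with hi | hi
    · rw [zcoeff_neg (VBp q) (by omega), LinearMap.zero_apply, TensorProduct.zero_tmul]
    · obtain ⟨n, hn⟩ := (ferU_isWeight K (fun _ : ℕ+ => 1)).1 y
      have := sum_vferm_annih_annih (t := t) hq (S := S) (n + 1).toNat (y := y)
        (ferU_mono K _ (by omega) hn) (fun j hj => h₀ j fun h => hj (hS h)) (N := -2 - i) (by omega)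
      rw [Finset.sum_product, ← TensorProduct.tmul_zero (R := K) (M := Bos K) (N := Fer K ℕ+)
        (zcoeff (VBp q) (-i) f), ← this]
      congr 1
      refine Finset.sum_congr rfl fun j _ => Finset.sum_congr rfl fun k _ => ?_
      have e : 2 * ((j : ℤ) + k) - 2 - i = 2 * (j + k) + (-2 - i) := by ring
      rw [e]

end FockLevel

/-! ### Comparison of the fermionic and bosonic coefficients -/

section Exchange

variable {K : Type*} [Field K]

open Finset.HasAntidiagonal in
theorem exchange_succ_eq_sum_range (q t : K) (n : ℕ) : exchange q t (n + 1)
    = -((1 - q) * (1 - t)) * ∑ m ∈ Finset.range (n + 1), t ^ m * q ^ (n - m) := by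
  rw [exchange_succ, ← Finset.Nat.sum_antidiagonal_swap,
    ← Finset.Nat.sum_antidiagonal_eq_sum_range_succ (fun i j => t ^ i * q ^ j)]
  congr 1
  refine Finset.sum_congr rfl fun p _ => ?_
  rw [mul_comm]
  rfl

/-- Row 0 vanishes, in agreement with the convention that ∂/∂π_0 is zero. -/
theorem fermMat_zero_left (q t : K) {j : ℕ} (hj : 0 < j) : fermMat q t 0 j = 0 := by
  simp [fermMat, pairSum, hj.ne]

/-- The fermionic matrix cancels the bosonic exchange coefficients, up to a term antisymmetrised
to zero and a term proportional to a delta function. -/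
theorem fermMat_sub_exchange {q t : K} (hq : q ≠ 0) (ht : t ≠ 0) (l : ℕ) {j : ℕ} (hj : 0 < j) :
    fermMat q t l j - (if l ≤ j then exchange q t (j - l) else 0)
      = (1 - t⁻¹) * (q - 1) * t ^ (2 - (l : ℤ)) * hSum q t j
        + if l = 0 then (1 - q) * (1 - t) * q ^ (j - 1) else 0 := by
  rcases lt_trichotomy l j with h | h | h
  · rw [if_pos h.le]
    rcases Nat.eq_zero_or_pos l with rfl | hl
    · rw [fermMat_zero_left q t hj, if_pos rfl]
      obtain ⟨i, rfl⟩ : ∃ i, j = i + 1 := ⟨j - 1, by omega⟩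
      rw [Nat.sub_zero, exchange_succ_eq_sum_range, Finset.sum_range_succ', hSum]
      have h1 : ∑ m ∈ Finset.range i, t ^ (m + 1) * q ^ (i - (m + 1))
          = t * ∑ m ∈ Finset.range (i + 1 - 1), t ^ m * q ^ (i + 1 - 2 - m) := by
        rw [Finset.mul_sum, Nat.add_sub_cancel]
        refine Finset.sum_congr rfl fun m _ => ?_
        rw [pow_succ']
        have : i - (m + 1) = i + 1 - 2 - m := by omega
        rw [this]
        ring
      rw [h1]
      have h2 : t ^ (2 - ((0 : ℕ) : ℤ)) = t ^ 2 := by norm_num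
      rw [h2]
      simp only [pow_zero, one_mul, Nat.sub_zero, Nat.add_sub_cancel]
      field_simp
      ring
    · rw [if_neg (by omega), add_zero, fermMat, if_neg (by omega), zero_add, pairSum,
        min_eq_left h.le]
      obtain ⟨i, rfl⟩ : ∃ i, j = l + i + 1 := ⟨j - l - 1, by omega⟩
      obtain ⟨k, rfl⟩ : ∃ k, l = k + 1 := ⟨l - 1, by omega⟩
      rw [show k + 1 + i + 1 - (k + 1) = i + 1 by omega, exchange_succ_eq_sum_range, hSum,
        show k + 1 + i + 1 - 1 = k + (i + 1) by omega, Finset.sum_range_add _ k (i + 1)]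
      have h1 : q ^ (((k + 1 + i + 1 : ℕ) : ℤ) - 2) * ∑ m ∈ Finset.range (k + 1 - 1),
          t ^ m * q ^ (-(m : ℤ))
          = ∑ m ∈ Finset.range k, t ^ m * q ^ (k + 1 + i + 1 - 2 - m) := by
        rw [Finset.mul_sum, Nat.add_sub_cancel]
        refine Finset.sum_congr rfl fun m hm => ?_
        rw [Finset.mem_range] at hm
        rw [← zpow_natCast q, mul_left_comm, ← zpow_add₀ hq]
        congr 2
        omega
      have h2 : ∑ m ∈ Finset.range (i + 1), t ^ (k + m) * q ^ (k + 1 + i + 1 - 2 - (k + m))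
          = t ^ k * ∑ m ∈ Finset.range (i + 1), t ^ m * q ^ (i - m) := by
        rw [Finset.mul_sum]
        refine Finset.sum_congr rfl fun m _ => ?_
        rw [pow_add, mul_assoc]
        congr 3
        omega
      have h3 : t ^ (2 - ((k + 1 : ℕ) : ℤ)) = t * (t ^ k)⁻¹ := by
        rw [show 2 - ((k + 1 : ℕ) : ℤ) = 1 - (k : ℤ) by push_cast; ring, zpow_sub₀ ht, zpow_one,
          zpow_natCast, div_eq_mul_inv]
      rw [h2, h3, mul_assoc (q - 1), h1]
      have hk : t ^ k ≠ 0 := pow_ne_zero _ ht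
      field_simp
      ring
  · subst h
    rw [if_pos le_rfl, if_neg (by omega), Nat.sub_self, exchange_zero, fermMat, if_pos rfl,
      ← mul_pairSum_of_le hq le_rfl]
    ring
  · rw [fermMat_of_lt hq h, if_neg (by omega), if_neg (by omega)]
    ring

end Exchange

/-! ### The anticommutators of the charges -/

section Anticommutators

variable {K : Type*} [Field K]

/-- `∂/∂π_n` for `n ≥ 1`, and zero for `n = 0`. -/
noncomputable def dpiNat (K : Type*) [Field K] (n : ℕ) : Module.End K (Fock K) :=
  if h : 0 < n then dpi K ⟨n, h⟩ else 0

theorem dpiNat_zero : dpiNat K 0 = 0 := by simp [dpiNat]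

theorem dpiNat_coe (k : ℕ+) : dpiNat K k = dpi K k := by
  rw [dpiNat, dif_pos k.pos]
  rfl

theorem exists_dpiNat_bound (v : Fock K) : ∃ m₀ : ℕ, ∀ n ≥ m₀, dpiNat K n v = 0 := by
  obtain ⟨S, hS⟩ := exists_dpi_support v
  refine ⟨S.sup (fun k => (k : ℕ)) + 1, fun n hn => ?_⟩
  obtain ⟨k, rfl⟩ := exists_pnat_of_pos (r := n) (by omega)
  rw [dpiNat_coe]
  refine hS k fun hk => ?_
  have := Finset.le_sup (f := fun k : ℕ+ => (k : ℕ)) hk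
  omega

/-- `∑ k ≥ 1, c_{k-r}[p] ∂/∂π_k`. -/
noncomputable def cCharge (t : K) (r : ℕ) : Module.End K (Fock K) :=
  lfSum (fun k : ℕ+ => polyMul K (cPoly t ((k : ℕ) - r)) * dpi K k) ((dpi_locFin K).comp_left _)

/-- `∑ k ≥ 1, q^k X_{2k+N} ∂/∂π_k`. -/
noncomputable def vCharge (q t : K) (N : ℤ) : Module.End K (Fock K) :=
  lfSum (fun k : ℕ+ => q ^ (k : ℕ) • (vertex q t (2 * (k : ℤ) + N) * dpi K k))
    (((dpi_locFin K).comp_left _).smul _)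

theorem lfSum_dpi_apply (A : ℕ+ → Module.End K (Fock K)) {B : ℕ+ → Module.End K (Fock K)}
    (hB : LocFin B) (hAB : ∀ k v, B k v = A k (dpi K k v)) {S : Finset ℕ+} {v : Fock K}
    (hS : ∀ j ∉ S, dpi K j v = 0) : lfSum B hB v = ∑ k ∈ S, A k (dpi K k v) := by
  rw [lfSum_apply, finsum_eq_sum_of_support_subset (s := S)]
  · exact Finset.sum_congr rfl fun k _ => hAB k v
  · intro k hk
    by_contra hcon
    refine hk ?_
    beta_reduce
    rw [hAB, hS k hcon, map_zero]

theorem cCharge_apply (t : K) (r : ℕ) {S : Finset ℕ+} {v : Fock K}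
    (hS : ∀ j ∉ S, dpi K j v = 0) :
    cCharge t r v = ∑ k ∈ S, polyMul K (cPoly t ((k : ℕ) - r)) (dpi K k v) :=
  lfSum_dpi_apply _ _ (fun _ _ => rfl) hS

theorem vCharge_apply (q t : K) (N : ℤ) {S : Finset ℕ+} {v : Fock K}
    (hS : ∀ j ∉ S, dpi K j v = 0) :
    vCharge q t N v = ∑ k ∈ S, q ^ (k : ℕ) • vertex q t (2 * (k : ℤ) + N) (dpi K k v) :=
  lfSum_dpi_apply (fun k => q ^ (k : ℕ) • vertex q t (2 * (k : ℤ) + N)) _ (fun _ _ => rfl) hS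

theorem cCharge_apply_range (t : K) {r : ℕ} (hr : r ≤ 1) {m : ℕ} {w : Fock K}
    (hm : ∀ n ≥ m, dpiNat K n w = 0) :
    cCharge t r w = ∑ a ∈ Finset.range m, polyMul K (cPoly t a) (dpiNat K (a + r) w) := by
  have h1 : cCharge t r w
      = ∑ i ∈ Finset.range m, polyMul K (cPoly t (i + 1 - r)) (dpiNat K (i + 1) w) := by
    rw [cCharge, lfSum_apply, ← finsum_comp_equiv Equiv.pnatEquivNat.symm,
      finsum_eq_sum_of_support_subset (s := Finset.range m)]
    · refine Finset.sum_congr rfl fun i _ => ?_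
      have := dpiNat_coe (K := K) (Nat.succPNat i)
      rw [Nat.succPNat_coe] at this
      rw [this]
      rfl
    · intro i hi
      rw [Finset.coe_range, Set.mem_Iio]
      by_contra hcon
      refine hi ?_
      have h := hm (Nat.succPNat i) (by rw [Nat.succPNat_coe]; omega)
      rw [dpiNat_coe] at h
      change polyMul K _ (dpi K (Nat.succPNat i) w) = 0
      rw [h, map_zero]
  rw [h1]
  interval_cases r
  · have := Finset.sum_range_succ' (fun a => polyMul K (cPoly t a) (dpiNat K (a + 0) w)) m
    rw [Finset.sum_range_succ, add_zero, hm m le_rfl, map_zero, add_zero, dpiNat_zero,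
      LinearMap.zero_apply, map_zero, add_zero] at this
    exact this.symm
  · rfl

variable [CharZero K]

theorem dpiNat_vertex (q t : K) (l : ℕ) (N : ℤ) {S : Finset ℕ+} {v : Fock K}
    (hS : ∀ j ∉ S, dpi K j v = 0) :
    dpiNat K l (vertex q t N v)
      = ∑ j ∈ S, fermMat q t l j • vertex q t (N - 2 * l + 2 * j) (dpi K j v) := by
  rcases Nat.eq_zero_or_pos l with rfl | hl
  · rw [dpiNat_zero, LinearMap.zero_apply]
    symm
    refine Finset.sum_eq_zero fun j _ => ?_
    rw [fermMat_zero_left q t j.pos, zero_smul]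
  · obtain ⟨k, rfl⟩ := exists_pnat_of_pos hl
    rw [dpiNat_coe, dpi_vertex q t k N hS]

theorem vertex_polyMul_cPoly_range (q t : K) (N : ℤ) {n m : ℕ} (h : n < m) (v : Fock K) :
    vertex q t N (polyMul K (cPoly t n) v) = ∑ a ∈ Finset.range m,
      (if a ≤ n then exchange q t (n - a) else 0) •
        polyMul K (cPoly t a) (vertex q t (N + 2 * n - 2 * a) v) := by
  rw [vertex_polyMul_cPoly, ← Finset.Nat.sum_antidiagonal_swap]
  simp only [Prod.fst_swap, Prod.snd_swap]
  rw [Finset.Nat.sum_antidiagonal_eq_sum_range_succ (fun a i => exchange q t i •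
    polyMul K (cPoly t a) (vertex q t (N + 2 * i) v))]
  have hsub : Finset.range n.succ ⊆ Finset.range m := by
    intro x
    simp only [Finset.mem_range]
    omega
  rw [← Finset.sum_subset hsub]
  · refine Finset.sum_congr rfl fun a ha => ?_
    rw [Finset.mem_range] at ha
    have e : N + 2 * ((n - a : ℕ) : ℤ) = N + 2 * n - 2 * a := by omega
    rw [if_pos (by omega), e]
  · intro a _ ha
    rw [Finset.mem_range] at ha
    rw [if_neg (by omega), zero_smul]

theorem smul_sub_smul_eq {R M : Type*} [CommRing R] [AddCommGroup M] [Module R M]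
    {a b c d e f : R} (w : M) (h : a - b = c * (d * e) + f) :
    a • w - b • w = c • d • e • w + f • w := by
  rw [← sub_smul, h, add_smul, mul_smul, mul_smul]

/-- The offset 2r - 2 gives both products the same modes 2(j+k) - 2 - 2a, so they can be compared
coefficient by coefficient. -/
theorem cCharge_vCharge_anticomm {q t : K} (hq : q ≠ 0) (ht : t ≠ 0) {r : ℕ} (hr : r ≤ 1)
    (v : Fock K) :
    cCharge t r (vCharge q t (2 * r - 2) v) + vCharge q t (2 * r - 2) (cCharge t r v) = 0 := by
  obtain ⟨S, hS⟩ := exists_dpi_support v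
  have hS' : ∀ k, ∀ j ∉ S, dpi K j (dpi K k v) = 0 := by
    intro k j hj
    rw [dpi_dpi, hS j hj, map_zero, neg_zero]
  have hSC : ∀ j ∉ S, dpi K j (cCharge t r v) = 0 := by
    intro j hj
    rw [cCharge_apply t r hS, map_sum]
    refine Finset.sum_eq_zero fun k _ => ?_
    rw [dpi_polyMul, hS' k j hj, map_zero]
  obtain ⟨m₁, hm₁⟩ := exists_dpiNat_bound (vCharge q t (2 * r - 2) v)
  obtain ⟨m₂, hm₂⟩ := exists_sum_cPoly_vertex_dpi_dpi hq ht hS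
  -- One range for a that serves both products and is long enough to cancel V_B^{(-)}.
  set m := max (max m₁ m₂) (S.sup (fun k => (k : ℕ)) + 1) with hm
  have hmS : ∀ j ∈ S, (j : ℕ) < m := by
    intro j hj
    have := Finset.le_sup (f := fun k : ℕ+ => (k : ℕ)) hj
    omega
  let W : ℕ → ℕ+ → ℕ+ → Fock K := fun a j k =>
    polyMul K (cPoly t a) (vertex q t (2 * (j + k) - 2 - 2 * a) (dpi K j (dpi K k v)))
  have hCG : cCharge t r (vCharge q t (2 * r - 2) v)
      = ∑ j ∈ S, ∑ k ∈ S, ∑ a ∈ Finset.range m, (q ^ (k : ℕ) * fermMat q t (a + r) j) • W a j k := by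
    rw [cCharge_apply_range t hr (m := m) fun n hn => hm₁ n (by omega), vCharge_apply q t _ hS]
    have h1 : ∀ a ∈ Finset.range m, polyMul K (cPoly t a) (dpiNat K (a + r)
        (∑ k ∈ S, q ^ (k : ℕ) • vertex q t (2 * (k : ℤ) + (2 * r - 2)) (dpi K k v)))
        = ∑ j ∈ S, ∑ k ∈ S, (q ^ (k : ℕ) * fermMat q t (a + r) j) • W a j k := by
      intro a _
      rw [map_sum, map_sum, Finset.sum_comm]
      refine Finset.sum_congr rfl fun k _ => ?_
      rw [map_smul, map_smul, dpiNat_vertex q t _ _ (hS' k), map_sum, Finset.smul_sum]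
      refine Finset.sum_congr rfl fun j _ => ?_
      have e : 2 * (k : ℤ) + (2 * r - 2) - 2 * ((a + r : ℕ) : ℤ) + 2 * j
          = 2 * (j + k) - 2 - 2 * a := by push_cast; ring
      rw [map_smul, smul_smul, e]
    rw [Finset.sum_congr rfl h1, Finset.sum_comm]
    exact Finset.sum_congr rfl fun j _ => Finset.sum_comm
  -- The minus sign comes from reordering ∂/∂π_k ∂/∂π_j into the order used in `W`.
  have hGC : vCharge q t (2 * r - 2) (cCharge t r v)
      = -∑ j ∈ S, ∑ k ∈ S, ∑ a ∈ Finset.range m,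
          (q ^ (k : ℕ) * (if a + r ≤ j then exchange q t (j - (a + r)) else 0)) • W a j k := by
    rw [vCharge_apply q t _ hSC, cCharge_apply t r hS, Finset.sum_comm, ← Finset.sum_neg_distrib]
    refine Finset.sum_congr rfl fun k _ => ?_
    rw [map_sum, map_sum, Finset.smul_sum, ← Finset.sum_neg_distrib]
    refine Finset.sum_congr rfl fun j hj => ?_
    have hjr : r ≤ j := hr.trans j.pos
    rw [dpi_polyMul, vertex_polyMul_cPoly_range q t _ (m := m) (by have := hmS j hj; omega),
      Finset.smul_sum, ← Finset.sum_neg_distrib]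
    refine Finset.sum_congr rfl fun a _ => ?_
    have e : 2 * (k : ℤ) + (2 * r - 2) + 2 * (((j : ℕ) - r : ℕ) : ℤ) - 2 * a
        = 2 * (j + k) - 2 - 2 * a := by omega
    have e2 : (j : ℕ) - r - a = j - (a + r) := by omega
    have e3 : (a ≤ (j : ℕ) - r) ↔ a + r ≤ j := by omega
    rw [e, e2, dpi_dpi k j, map_neg, map_neg, smul_neg, smul_neg, smul_smul]
    simp only [e3, W]
  rw [hCG, hGC, ← sub_eq_add_neg]
  -- The power t^(2-(a+r)) factors as t^(2-r) t^(-a), which is the weight that makes ∑ c_a t^(-a)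
  -- w^(2a) appear.
  have hcoef : ∀ j k : ℕ+, ∀ a : ℕ, (q ^ (k : ℕ) * fermMat q t (a + r) j) • W a j k
      - (q ^ (k : ℕ) * if a + r ≤ j then exchange q t (j - (a + r)) else 0) • W a j k
      = ((1 - t⁻¹) * (q - 1) * t ^ (2 - (r : ℤ))) • ((hSum q t j * q ^ (k : ℕ)) •
          ((t⁻¹ ^ a) • W a j k))
        + (if a + r = 0 then ((1 - q) * (1 - t) * q⁻¹ * q ^ ((j : ℕ) + k)) else 0) • W a j k := by
    intro j k a
    refine smul_sub_smul_eq _ ?_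
    rw [← mul_sub, fermMat_sub_exchange hq ht _ j.pos]
    have h1 : t ^ (2 - ((a + r : ℕ) : ℤ)) = t ^ (2 - (r : ℤ)) * t⁻¹ ^ a := by
      rw [show 2 - ((a + r : ℕ) : ℤ) = (2 - (r : ℤ)) - (a : ℤ) by push_cast; ring, zpow_sub₀ ht,
        zpow_natCast, inv_pow, div_eq_mul_inv]
    rw [h1]
    split_ifs with h
    · obtain ⟨i, hi⟩ : ∃ i, (j : ℕ) = i + 1 := ⟨j - 1, by have := j.pos; omega⟩
      rw [hi, Nat.add_sub_cancel]
      field_simp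
      ring
    · ring
  simp only [← Finset.sum_sub_distrib]
  simp only [hcoef, Finset.sum_add_distrib, ← Finset.smul_sum]
  have hR := hm₂ m (by omega)
  rw [hR, smul_zero, zero_add]
  -- What remains has weight q^(j+k), symmetric in j and k, against the antisymmetric ∂/∂π_j ∂/∂π_k.
  refine sum_sum_eq_zero_of_antisymm (K := K) S _ fun j _ k _ => ?_
  rw [← Finset.sum_neg_distrib]
  refine Finset.sum_congr rfl fun a _ => ?_
  simp only [W]
  rw [dpi_dpi j k, map_neg, map_neg, smul_neg, add_comm (j : ℕ), add_comm (j : ℤ)]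

end Anticommutators

/-! ### The mode relation for F_{1,0} -/

section ModeRelation

variable {K : Type*} [Field K]

theorem dpi_bosOp (k : ℕ+) (A : Module.End K (Bos K)) (v : Fock K) :
    dpi K k (bosOp K A v) = bosOp K A (dpi K k v) := by
  induction v using TensorProduct.induction_on with
  | zero => simp
  | tmul f y => rfl
  | add x y hx hy => simp only [map_add, hx, hy]

theorem dpi_piMul [DecidableEq ℕ+] (l k : ℕ+) (v : Fock K) :
    dpi K l (piMul K k v) = (if l = k then v else 0) - piMul K k (dpi K l v) := by
  induction v using TensorProduct.induction_on with
  | zero => simp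
  | tmul f y =>
    change f ⊗ₜ[K] annih K l (create K k y) = _ - f ⊗ₜ[K] create K k (annih K l y)
    have := LinearMap.congr_fun (annih_mul_create K l k) y
    rw [Module.End.mul_apply] at this
    rw [this, LinearMap.sub_apply, TensorProduct.tmul_sub]
    split_ifs
    · rfl
    · simp [Module.End.mul_apply]
  | add x y hx hy =>
    simp only [map_add, hx, hy]
    split_ifs <;> abel

theorem dpi_E20 (t : K) (l : ℕ+) (v : Fock K) : dpi K l (E20 t v) = -E20 t (dpi K l v) := by
  obtain ⟨S, hS⟩ := exists_dpi_support v
  have hS' : ∀ j ∉ S, dpi K j (dpi K l v) = 0 := by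
    intro j hj
    rw [dpi_dpi, hS j hj, map_zero, neg_zero]
  change dpi K l (cCharge t 0 v) = -cCharge t 0 (dpi K l v)
  rw [cCharge_apply t 0 hS, cCharge_apply t 0 hS', map_sum, ← Finset.sum_neg_distrib]
  refine Finset.sum_congr rfl fun k _ => ?_
  rw [dpi_polyMul, dpi_dpi, map_neg]

/-- Only the term k = 1 of F_{2,-1} contains π_1; all the others anticommute with ∂/∂π_1. -/
theorem dpi_F2m1 (q : K) (v : Fock K) :
    dpi K 1 (F2m1 q v) + F2m1 q (dpi K 1 v) = -bosOp K (cTilde q 1) v := by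
  classical
  have hf := fun w => piMul_cTilde_locFin q w
  have h1 : dpi K 1 (F2m1 q v) = -(bosOp K (cTilde q 1) v
      - ∑ᶠ k : ℕ+, (piMul K k * bosOp K (cTilde q k)) (dpi K 1 v)) := by
    rw [F2m1, LinearMap.neg_apply, map_neg, lfSum_apply, map_finsum _ (hf v)]
    congr 1
    have h2 : ∀ k : ℕ+, dpi K 1 ((piMul K k * bosOp K (cTilde q k)) v)
        = (if (1 : ℕ+) = k then bosOp K (cTilde q k) v else 0)
          - (piMul K k * bosOp K (cTilde q k)) (dpi K 1 v) := by
      intro k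
      rw [Module.End.mul_apply, dpi_piMul, dpi_bosOp]
      rfl
    rw [finsum_congr h2, finsum_sub_distrib _ (hf _)]
    · rw [finsum_eq_single _ 1 fun k hk => if_neg (Ne.symm hk), if_pos rfl]
      rfl
    · refine (Set.finite_singleton 1).subset fun k hk => ?_
      by_contra h
      exact hk (if_neg (Ne.symm h))
  rw [h1, F2m1, LinearMap.neg_apply, lfSum_apply]
  abel

theorem cTilde_one (q : K) : cTilde q 1 = (q⁻¹ - 1) • dp K 1 := by
  rw [cTilde, cTildeSeries, fexp, PowerSeries.coeff_mk, Finset.sum_range_succ,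
    Finset.sum_range_succ, Finset.sum_range_zero, pow_zero, pow_one]
  have := coeff_gen_id (fun n : ℕ+ => (q ^ (-(n : ℤ)) - 1) • dp K n) 1
  rw [PNat.one_coe] at this
  rw [this]
  simp [PowerSeries.coeff_one]

variable [CharZero K]

/-- In the exponent of ∑ c_n z^n, ∂/∂p_1 sees only (1-t) p_1 z, so it multiplies the series by (1-t)
z. -/
theorem dp_one_cPoly_mul (t : K) {n : ℕ} (hn : 0 < n) (f : Bos K) :
    dp K 1 (cPoly t n * f) = cPoly t n * dp K 1 f + (1 - t) • (cPoly t (n - 1) * f) := by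
  classical
  obtain ⟨m, rfl⟩ := exists_pnat_of_pos hn
  set X : ℕ+ → Bos K := fun r => ((1 - t ^ (r : ℕ)) / (r : ℕ)) • (MvPolynomial.X r : Bos K)
  have hc : ∀ (i : ℕ) (g : Bos K), zcoeff (fexp K (gen (fun r => (r : ℕ))
      fun k => Algebra.lmul K (Bos K) (X k))) (i : ℤ) g = cPoly t i * g := by
    intro i g
    rw [zcoeff_natCast, coeff_fexp_gen_map]
    rfl
  have key := End.mul_zcoeff_fexp_gen (K := K) (e := fun k : ℕ+ => (k : ℕ)) (fun _ => le_rfl)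
    (D := dp K 1) (a := fun k => Algebra.lmul K (Bos K) (X k))
    (b := fun k => if k = 1 then (1 - t) • (1 : Module.End K (Bos K)) else 0)
    (n := (m : ℕ)) (S := Finset.Iic m) ?_ ?_ ?_
  · have := LinearMap.congr_fun key f
    simp only [mul_ite, mul_zero] at this
    rw [Finset.sum_ite_eq', if_pos (by simp), mul_smul_comm, mul_one] at this
    simp only [Module.End.mul_apply, LinearMap.add_apply, LinearMap.smul_apply] at this
    have e : ((m : ℕ) : ℤ) - ((1 : ℕ+) : ℕ) = (((m : ℕ) - 1 : ℕ) : ℤ) := by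
      rw [PNat.one_coe]; omega
    rwa [e, hc, hc, hc] at this
  · intro k
    apply LinearMap.ext
    intro g
    change MvPolynomial.pderiv 1 (X k * g) = X k * MvPolynomial.pderiv 1 g + _
    rw [Derivation.leibniz, Derivation.map_smul, MvPolynomial.pderiv_X, smul_eq_mul, smul_eq_mul]
    congr 1
    by_cases h : k = 1
    · subst h
      simp
    · simp [h]
  · intro k l
    split_ifs
    · exact (Commute.one_right _).smul_right _
    · exact Commute.zero_right _
  · intro k hk
    rw [Finset.mem_Iic, ← PNat.coe_le_coe]
    exact_mod_cast hk

theorem bosOp_dp_polyMul_cPoly (t : K) {n : ℕ} (hn : 0 < n) (v : Fock K) :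
    bosOp K (dp K 1) (polyMul K (cPoly t n) v) = polyMul K (cPoly t n) (bosOp K (dp K 1) v)
      + (1 - t) • polyMul K (cPoly t (n - 1)) v := by
  induction v using TensorProduct.induction_on with
  | zero => simp
  | tmul f y =>
    change dp K 1 (cPoly t n * f) ⊗ₜ[K] y = (cPoly t n * dp K 1 f) ⊗ₜ[K] y
      + (1 - t) • ((cPoly t (n - 1) * f) ⊗ₜ[K] y)
    rw [dp_one_cPoly_mul t hn, TensorProduct.add_tmul, TensorProduct.smul_tmul']
  | add x y hx hy =>
    simp only [map_add, hx, hy, smul_add]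
    abel

theorem bosOp_dp_E20 (t : K) (v : Fock K) :
    bosOp K (dp K 1) (E20 t v) = E20 t (bosOp K (dp K 1) v) + (1 - t) • cCharge t 1 v := by
  obtain ⟨S, hS⟩ := exists_dpi_support v
  have hS' : ∀ j ∉ S, dpi K j (bosOp K (dp K 1) v) = 0 := by
    intro j hj
    rw [dpi_bosOp, hS j hj, map_zero]
  change bosOp K (dp K 1) (cCharge t 0 v) = cCharge t 0 (bosOp K (dp K 1) v) + _
  rw [cCharge_apply t 0 hS, cCharge_apply t 0 hS', cCharge_apply t 1 hS, map_sum,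
    Finset.smul_sum, ← Finset.sum_add_distrib]
  refine Finset.sum_congr rfl fun k _ => ?_
  rw [Nat.sub_zero, bosOp_dp_polyMul_cPoly t k.pos, dpi_bosOp]

/-- By the super Jacobi identity, and since ∂/∂π_1 anticommutes with E_{2,0}, the commutator reduces
to that of ∂/∂p_1 with E_{2,0}, which lowers the index of each c_k by one. -/
theorem H2m1_F11_commutator (q t u s : K) (v : Fock K) :
    H2m1 q t u s (F11 v) - F11 (H2m1 q t u s v)
      = (-((s * u)⁻¹ * ((q⁻¹ - 1) * (1 - t)))) • cCharge t 1 v := by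
  have hG : ∀ w : Fock K, dpi K 1 (F2m1 q w) + F2m1 q (dpi K 1 w)
      = -((q⁻¹ - 1) • bosOp K (dp K 1) w) := by
    intro w
    rw [dpi_F2m1, cTilde_one]
    congr 1
    simp only [bosOp, tens, TensorProduct.map_smul_left]
    rfl
  have h1 := congrArg (E20 t) (hG v)
  have h2 := hG (E20 t v)
  rw [bosOp_dp_E20] at h2
  simp only [map_add, map_neg, map_smul] at h1
  have h3 := dpi_E20 t 1 (F2m1 q v)
  have h4 := congrArg (F2m1 q) (dpi_E20 t 1 v)
  rw [map_neg] at h4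
  rw [h4] at h2
  rw [H2m1, F11]
  simp only [LinearMap.smul_apply, LinearMap.sub_apply, LinearMap.add_apply, Module.End.mul_apply,
    Module.End.one_apply, map_smul, map_sub, map_add]
  rw [h3, ← smul_sub]
  have h5 : E20 t (F2m1 q (dpi K 1 v)) = -((q⁻¹ - 1) • E20 t (bosOp K (dp K 1) v))
      - E20 t (dpi K 1 (F2m1 q v)) := eq_sub_of_add_eq' h1
  have h6 : dpi K 1 (F2m1 q (E20 t v)) = -((q⁻¹ - 1) • (E20 t (bosOp K (dp K 1) v)
      + (1 - t) • cCharge t 1 v)) + F2m1 q (E20 t (dpi K 1 v)) := by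
    rw [← h2]; abel
  rw [h5, h6]
  module

end ModeRelation

end SuperMacdonald

theorem proposition1p3 {K : Type*} [Field K] [CharZero K] (q t u rq rt : K)
    (hq : q ≠ 0) (ht : t ≠ 0) (hu : u ≠ 0) (hrq : rq ^ 2 = q) (hrt : rt ^ 2 = t) :
    (SuperMacdonald.H2m1 q t u (rt / rq) * SuperMacdonald.F11
        - SuperMacdonald.F11 * SuperMacdonald.H2m1 q t u (rt / rq)
      = (-((rq - rq⁻¹) * (rt - rt⁻¹))) • SuperMacdonald.F10 t u) ∧
    (SuperMacdonald.E21 q t u (rt / rq) * SuperMacdonald.F10 t u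
        + SuperMacdonald.F10 t u * SuperMacdonald.E21 q t u (rt / rq) = 0) ∧
    (SuperMacdonald.E20 t * SuperMacdonald.F12 q t u
        + SuperMacdonald.F12 q t u * SuperMacdonald.E20 t = 0) := by
  have hF10 : SuperMacdonald.F10 t u = u⁻¹ • SuperMacdonald.cCharge t 1 := rfl
  have hE20 : SuperMacdonald.E20 t = SuperMacdonald.cCharge t 0 := rfl
  have hE21 : ∀ v, SuperMacdonald.E21 q t u (rt / rq) v
      = -((u * (rt / rq)) • SuperMacdonald.vCharge q t (2 * (1 : ℕ) - 2) v) := by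
    intro v
    obtain ⟨S, hS⟩ := SuperMacdonald.exists_dpi_support v
    rw [SuperMacdonald.vCharge_apply q t _ hS, SuperMacdonald.E21, LinearMap.neg_apply,
      LinearMap.smul_apply, SuperMacdonald.lfSum_dpi_apply
        (fun k => q ^ (k : ℕ) • SuperMacdonald.vertex q t (2 * (k : ℤ))) _ (fun _ _ => rfl) hS]
    simp
  -- The weight q^(k-1) is q⁻¹ q^k and the mode 2k - 2 is the case r = 0; for E_{2,1} the mode 2k is
  -- the case r = 1.
  have hF12 : ∀ v, SuperMacdonald.F12 q t u v
      = (u * q⁻¹) • SuperMacdonald.vCharge q t (2 * (0 : ℕ) - 2) v := by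
    intro v
    obtain ⟨S, hS⟩ := SuperMacdonald.exists_dpi_support v
    rw [SuperMacdonald.vCharge_apply q t _ hS, SuperMacdonald.F12, LinearMap.smul_apply,
      SuperMacdonald.lfSum_dpi_apply (fun k => q ^ ((k : ℕ) - 1) •
        SuperMacdonald.vertex q t (2 * (k : ℤ) - 2)) _ (fun _ _ => rfl) hS, mul_smul,
      Finset.smul_sum (r := q⁻¹)]
    congr 1
    refine Finset.sum_congr rfl fun k _ => ?_
    obtain ⟨i, hi⟩ : ∃ i, (k : ℕ) = i + 1 := ⟨k - 1, by have := k.pos; omega⟩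
    have e : 2 * ((k : ℕ) : ℤ) + (2 * ((0 : ℕ) : ℤ) - 2) = 2 * (k : ℤ) - 2 := by
      push_cast; ring
    rw [e, smul_smul, LinearMap.smul_apply]
    congr 1
    rw [hi, Nat.add_sub_cancel, pow_succ]
    field_simp
  refine ⟨?_, ?_, ?_⟩ <;> apply LinearMap.ext <;> intro v
  · refine (SuperMacdonald.H2m1_F11_commutator q t u (rt / rq) v).trans ?_
    rw [hF10, LinearMap.smul_apply, LinearMap.smul_apply, smul_smul]
    congr 1
    -- The scalars agree because (rq/rt)(q⁻¹ - 1)(1 - t) = (rq - rq⁻¹)(rt - rt⁻¹).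
    have h1 : rq ≠ 0 := by rintro rfl; exact hq (by rw [← hrq]; ring)
    have h2 : rt ≠ 0 := by rintro rfl; exact ht (by rw [← hrt]; ring)
    rw [← hrq, ← hrt]
    field_simp
    ring
  · rw [LinearMap.add_apply, Module.End.mul_apply, Module.End.mul_apply, hE21, hE21, hF10]
    simp only [LinearMap.smul_apply, map_neg, map_smul]
    have h := SuperMacdonald.cCharge_vCharge_anticomm hq ht (le_refl 1) v
    rw [← neg_add, ← smul_add, ← smul_add, add_comm, h]
    simp
  · rw [LinearMap.add_apply, Module.End.mul_apply, Module.End.mul_apply, hF12, hF12, hE20, map_smul,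
      ← smul_add, SuperMacdonald.cCharge_vCharge_anticomm hq ht zero_le_one v]
    simp
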